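/- **Setting.** Let $r\ge 2$, $1\le k\le n$, $\Theta_k=\{v\in\{0,1\}^n:\|v\|_0=k\}$ (where $\|v\|_0$ is the number of nonzero entries), and let $\theta\sim\mathrm{Unif}(\Theta_k)$. One observes the tensor $Y=\frac{\lambda}{k^{r/2}}\theta^{\otimes r}+W\in\mathbb R^{n^{\otimes r}}$, where $W$ is independent of $\theta$ and has i.i.d. $\mathcal N(0,1)$ entries. For $\beta,\gamma>0$ and $\sigma\in\{0,1\}^n$ put $H_{\beta,\gamma}(\sigma)=\langle\sigma^{\otimes r},Y\rangle-\gamma\|\sigma\|_0^{\beta}$. **Norm-constrained randomized greedy search on $H_{(r+1)/2,\gamma}$** with input $(Y,\sigma_0,M)$: set $S_1=\sigma_0$. For $t=1,\dots,M-1$, choose $\sigma'$ uniformly at random, with fresh randomness independent of everything else, among the vectors in $\{0,1\}^n$ at Hamming distance $1$ from $S_t$ with $\|\sigma'\|_0\le\frac32k$; set $S_{t+1}=\sigma'$ if $H_{(r+1)/2,\gamma}(\sigma')-H_{(r+1)/2,\gamma}(S_t)>0$, and $S_{t+1}=S_t$ otherwise. The output is $S_M$. **Theorem.** For every integer $r\ge2$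 there are constants $C_\lambda,C_\gamma>0$ depending only on $r$ such that for all constants $c,c'>0$ there is $N$ for which the following holds for all $n\ge N$. Let $$c\sqrt n\le k\le n,\qquad \gamma=C_\gamma\sqrt{\log n},\qquad \lambda\ge C_\lambda\,\frac{n^{(r-1)/2}}{k^{r/2-1}}\sqrt{\log n},\qquad M\ge c'\,n\,k^{(r+1)/2},$$ and let $\sigma_0\in\{0,1\}^n$, which may depend on $\theta$ and $W$, satisfy $\langle\sigma_0,\theta\rangle\ge\frac18k$ and $\|\sigma_0\|_0\le\frac32k$ almost surely. Then the norm-constrained randomized greedy search on $H_{(r+1)/2,\gamma}$ with input $(Y,\sigma_0,M)$ outputs $\theta$ with probability at least $2/3$; this holds conditionally on each value of $\theta\in\Theta_k$, and hence also for $\theta\sim\mathrm{Unif}(\Theta_k)$. (In particular it holds for $k=\Omega(\sqrt n)$, $M=\Theta(nk^{(r+1)/2})$, $\lambda=\omega\big(\sqrt{\log n}\,n^{(r-1)/2}/k^{r/2-1}\big)$ and all sufficiently large $n$.) -/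

import Mathlib

open MeasureTheory ProbabilityTheory

namespace SparseTensorPCA

/-- The binary cube `{0,1}^n`. Its `ℓ₀`-norm is `hammingNorm` and its Hamming distance is
`hammingDist`. -/
abbrev Cube (n : ℕ) : Type := Fin n → Fin 2

/-- Real tensors of order `r` on `ℝ^n`, with all `n ^ r` entries free (no symmetry). -/
abbrev Tensor (n r : ℕ) : Type := (Fin r → Fin n) → ℝ

/-- A binary vector as a vector with real entries. -/
def toVec {n : ℕ} (σ : Cube n) : Fin n → ℝ := fun i => ((σ i : ℕ) : ℝ)

/-- The inner product `⟨σ, θ⟩` of two binary vectors. -/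
def overlap {n : ℕ} (σ θ : Cube n) : ℝ := ∑ i, toVec σ i * toVec θ i

/-- The tensor power `v^{⊗ r}`. -/
def tensorPow {n : ℕ} (r : ℕ) (v : Fin n → ℝ) : Tensor n r := fun h => ∏ j, v (h j)

/-- The entrywise inner product of two tensors. -/
def tensorInner {n r : ℕ} (A B : Tensor n r) : ℝ := ∑ h, A h * B h

/-- The set `Θ_k` of binary vectors with exactly `k` nonzero coordinates. -/
def sparseCube (n k : ℕ) : Set (Cube n) := {v | hammingNorm v = k}

/-- The binary prior: the uniform distribution on `Θ_k`. -/
noncomputable def signalLaw (n k : ℕ) : Measure (Cube n) := uniformOn (sparseCube n k)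

/-- The law of a tensor with i.i.d. standard Gaussian entries. -/
noncomputable def noiseLaw (n r : ℕ) : Measure (Tensor n r) :=
  Measure.pi fun _ => gaussianReal 0 1

/-- The observed tensor `Y = (lam / k^{r/2}) θ^{⊗ r} + W`. -/
noncomputable def observation {n r : ℕ} (k : ℕ) (lam : ℝ) (θ : Cube n) (W : Tensor n r) :
    Tensor n r :=
  (lam / (k : ℝ) ^ ((r : ℝ) / 2)) • tensorPow r (toVec θ) + W

/-- The objective `H_{β,γ}(σ) = ⟨σ^{⊗ r}, Y⟩ - γ ‖σ‖₀^β`. -/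
noncomputable def hamiltonian {n r : ℕ} (β γ : ℝ) (Y : Tensor n r) (σ : Cube n) : ℝ :=
  tensorInner (tensorPow r (toVec σ)) Y - γ * (hammingNorm σ : ℝ) ^ β

/-- The admissible neighbours of `σ`: the binary vectors at Hamming distance one from `σ` whose
`ℓ₀`-norm is at most `3k/2`. -/
noncomputable def neighbors {n : ℕ} (k : ℕ) (σ : Cube n) : Finset (Cube n) :=
  Finset.univ.filter fun σ' => hammingDist σ σ' = 1 ∧ (hammingNorm σ' : ℝ) ≤ 3 / 2 * (k : ℝ)

/-- One iteration of norm-constrained randomized greedy search on `H_{(r+1)/2,γ}`: propose a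
uniformly random admissible neighbour, move there if the objective strictly increases, and stay
otherwise. (If there is no admissible neighbour, the state does not change; for `n, k ≥ 1` this
does not occur from a state with `‖σ‖₀ ≤ 3k/2`.) -/
noncomputable def greedyStep {n r : ℕ} (k : ℕ) (γ : ℝ) (Y : Tensor n r) (σ : Cube n) :
    PMF (Cube n) :=
  if h : (neighbors k σ).Nonempty then
    (PMF.uniformOfFinset (neighbors k σ) h).map fun σ' =>
      if 0 < hamiltonian (((r : ℝ) + 1) / 2) γ Y σ' - hamiltonian (((r : ℝ) + 1) / 2) γ Y σ
      then σ' else σ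
  else PMF.pure σ

/-- The law of the state after `t` iterations started from `σ₀`, each iteration using fresh
independent randomness. -/
noncomputable def greedyRun {n r : ℕ} (k : ℕ) (γ : ℝ) (Y : Tensor n r) (σ₀ : Cube n) :
    ℕ → PMF (Cube n)
  | 0 => PMF.pure σ₀
  | t + 1 => (greedyRun k γ Y σ₀ t).bind (greedyStep k γ Y)

/-- The law of the output `S_M` on input `(Y, σ₀, M)`; here `S_1 = σ₀`, so that `S_M` is the state
after `M - 1` iterations. -/
noncomputable def greedyOutput {n r : ℕ} (k : ℕ) (γ : ℝ) (Y : Tensor n r) (σ₀ : Cube n) (M : ℕ) :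
    PMF (Cube n) :=
  greedyRun k γ Y σ₀ (M - 1)

/-- The probability, over the noise `W` and the randomness of the search, that the output is the
signal, given that the signal is `θ`. The starting point may depend on `W`. -/
noncomputable def successProb {n r : ℕ} (k : ℕ) (lam γ : ℝ) (M : ℕ)
    (σ₀ : Tensor n r → Cube n) (θ : Cube n) : ENNReal :=
  ∫⁻ W, greedyOutput k γ (observation k lam θ W) (σ₀ W) M θ ∂(noiseLaw n r)

end SparseTensorPCA

/-! Write `u = k^{(r-1)/2} √(log n)`, `s = λ / k^{r/2}`, and `d` for the Hamming distance from `σ`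
to `θ`.

Noise. For a fixed `σ`, the noise difference between `θ` and `σ`, and the total noise of the single
flips adding all missing coordinates (or removing all superfluous ones), are Gaussian of variance
`O(d k^{r-1})`. At most `n^d` points lie at distance `d`, so a union bound makes all these
quantities `O(d u)` at once (`noiseLaw_not_goodNoise_le`). The rest takes place on this event.

Drift. While the overlap is at least `k/16`, the penalty slope is of order `u` and the signal slope
dominates it. If superfluous coordinates are at least as many as missing ones, removals gain at
least `d u` in total; otherwise additions do (`exists_sum_energy_sub_ge`). The overlap stays above
`k/16` because the objective never decreases (`overlap_ge_of_energy_ge`). The gap to the objective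
at `θ` is `O(d s k^{r-1})` (`energy_sub_le`), so a uniform proposal among at most `n` neighbours
contracts the expected gap by a fixed factor. Since every other reachable state has gap at least
`u`, Markov's inequality bounds the failure probability.

Strong signals. A large `s` would slow this rate. But once `s k^{r-1}` exceeds a multiple of `k u`,
a change of overlap alone decides acceptance, and at equal overlap the signal cancels; so the
accepted moves no longer depend on `s` (`energy_lt_iff_energy_lt`). The potential may therefore use
a capped strength, with gap initially `O(k² u)` and contraction `1 - Ω(1/(nk))`. As `r ≥ 2`, the
number of steps is of order at least `n k^{3/2}`, which suffices for large `k`. -/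

namespace SparseTensorPCA

open scoped ENNReal

/-! ### Expectations under probability mass functions -/

section Expectation

variable {α β : Type*}

/-- The expectation of a nonnegative function under a probability mass function. -/
noncomputable def expect (p : PMF α) (g : α → ℝ≥0∞) : ℝ≥0∞ := ∑' a, p a * g a

theorem expect_pure (a : α) (g : α → ℝ≥0∞) : expect (PMF.pure a) g = g a := by
  classical
  unfold expect
  rw [tsum_eq_single a]
  · simp
  · intro b hb
    simp [PMF.pure_apply, hb]

theorem expect_bind (p : PMF α) (f : α → PMF β) (g : β → ℝ≥0∞) :
    expect (p.bind f) g = expect p fun a => expect (f a) g := by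
  unfold expect
  simp_rw [PMF.bind_apply, ← ENNReal.tsum_mul_right, ← ENNReal.tsum_mul_left]
  rw [ENNReal.tsum_comm]
  simp_rw [mul_assoc]

theorem expect_map (p : PMF α) (f : α → β) (g : β → ℝ≥0∞) :
    expect (p.map f) g = expect p fun a => g (f a) := by
  unfold PMF.map
  rw [expect_bind]
  simp [expect_pure]

theorem expect_uniformOfFinset (s : Finset α) (hs : s.Nonempty) (g : α → ℝ≥0∞) :
    expect (PMF.uniformOfFinset s hs) g = ∑ a ∈ s, (s.card : ℝ≥0∞)⁻¹ * g a := by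
  unfold expect
  rw [tsum_eq_sum (s := s)]
  · refine Finset.sum_congr rfl fun a ha => ?_
    rw [PMF.uniformOfFinset_apply_of_mem _ ha]
  · intro a ha
    simp [PMF.uniformOfFinset_apply_of_notMem _ ha]

theorem expect_le_of_support (p : PMF α) (g g' : α → ℝ≥0∞)
    (h : ∀ a ∈ p.support, g a ≤ g' a) : expect p g ≤ expect p g' := by
  refine ENNReal.tsum_le_tsum fun a => ?_
  by_cases ha : a ∈ p.support
  · gcongr
    exact h a ha
  · rw [PMF.mem_support_iff, not_not] at ha
    simp [ha]

theorem expect_const_mul (p : PMF α) (c : ℝ≥0∞) (g : α → ℝ≥0∞) :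
    expect p (fun a => c * g a) = c * expect p g := by
  unfold expect
  rw [← ENNReal.tsum_mul_left]
  exact tsum_congr fun a => by ring

/-- Markov's inequality for the event that a potential is not at its minimiser. -/
theorem one_le_add_expect_div (p : PMF α) (g : α → ℝ≥0∞) (a₀ : α) (δ : ℝ≥0∞)
    (hδ : δ ≠ 0) (hδ' : δ ≠ ∞) (h : ∀ a ∈ p.support, a ≠ a₀ → δ ≤ g a) :
    1 ≤ p a₀ + expect p g / δ := by
  classical
  have h1 : expect p (fun a => if a = a₀ then 1 else 0) = p a₀ := by
    unfold expect
    rw [tsum_eq_single a₀] <;> simp +contextual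
  have h2 : expect p (fun _ => 1) = 1 := by simp [expect, p.tsum_coe]
  have h3 : expect p g / δ = expect p fun a => δ⁻¹ * g a := by
    rw [expect_const_mul, ENNReal.div_eq_inv_mul]
  have h4 : ∀ u v : α → ℝ≥0∞, expect p u + expect p v = expect p fun a => u a + v a := by
    intro u v
    unfold expect
    rw [← ENNReal.tsum_add]
    exact tsum_congr fun a => by ring
  rw [← h1, h3, h4]
  nth_rewrite 1 [← h2]
  refine expect_le_of_support _ _ _ fun a ha => ?_
  by_cases hab : a = a₀
  · simp [hab]
  · have := h a ha hab
    simp only [hab, if_false, zero_add]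
    calc (1 : ℝ≥0∞) = δ⁻¹ * δ := (ENNReal.inv_mul_cancel hδ hδ').symm
      _ ≤ _ := by gcongr

end Expectation

/-! ### Contraction of a potential along the search -/

section Chain

variable {n r : ℕ} {k : ℕ} {γ : ℝ} {Y : Tensor n r}

theorem support_greedyRun_subset {R : Set (Cube n)} {σ₀ : Cube n} (h0 : σ₀ ∈ R)
    (hR : ∀ σ ∈ R, (greedyStep k γ Y σ).support ⊆ R) (t : ℕ) :
    (greedyRun k γ Y σ₀ t).support ⊆ R := by
  induction t with
  | zero => simpa [greedyRun] using h0
  | succ t ih =>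
    intro τ hτ
    rw [greedyRun, PMF.mem_support_bind_iff] at hτ
    obtain ⟨σ, hσ, hτ⟩ := hτ
    exact hR σ (ih hσ) hτ

/-- Contraction is only available on `R`; invariance of `R` keeps the run inside it, so the one-step
bound iterates. -/
theorem expect_greedyRun_le {R : Set (Cube n)} {σ₀ : Cube n} (h0 : σ₀ ∈ R)
    (hR : ∀ σ ∈ R, (greedyStep k γ Y σ).support ⊆ R) (g : Cube n → ℝ≥0∞) (ρ : ℝ≥0∞)
    (hg : ∀ σ ∈ R, expect (greedyStep k γ Y σ) g ≤ ρ * g σ) (t : ℕ) :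
    expect (greedyRun k γ Y σ₀ t) g ≤ ρ ^ t * g σ₀ := by
  induction t with
  | zero => simp [greedyRun, expect_pure]
  | succ t ih =>
    rw [greedyRun, expect_bind]
    calc _ ≤ expect (greedyRun k γ Y σ₀ t) fun σ => ρ * g σ :=
          expect_le_of_support _ _ _ fun σ hσ => hg σ (support_greedyRun_subset h0 hR t hσ)
      _ = ρ * expect (greedyRun k γ Y σ₀ t) g := expect_const_mul _ _ _
      _ ≤ ρ * (ρ ^ t * g σ₀) := by gcongr
      _ = _ := by ring

theorem card_neighbors_le (k : ℕ) (σ : Cube n) : (neighbors k σ).card ≤ n := by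
  have hsub : neighbors k σ ⊆
      -- Addition is in `Fin 2`, so `1 + σ i` is the flipped bit.
      Finset.univ.image fun i => Function.update σ i (1 + σ i) := by
    intro τ hτ
    simp only [neighbors, Finset.mem_filter, Finset.mem_univ, true_and] at hτ
    obtain ⟨i, hi⟩ := Finset.card_eq_one.mp hτ.1
    refine Finset.mem_image.mpr ⟨i, Finset.mem_univ _, ?_⟩
    funext j
    have hj : σ j ≠ τ j ↔ j = i := by
      simpa using congrArg (j ∈ ·) hi
    by_cases hji : j = i
    · subst hji
      have := hj.mpr rfl
      simp only [Function.update_self]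
      revert this
      generalize σ j = x
      generalize τ j = y
      revert x y
      decide
    · rw [Function.update_of_ne hji]
      by_contra h
      exact hji (hj.mp h)
  calc _ ≤ _ := Finset.card_le_card hsub
    _ ≤ _ := Finset.card_image_le
    _ = n := by simp

theorem support_greedyStep {σ τ : Cube n} (hτ : τ ∈ (greedyStep k γ Y σ).support) :
    τ = σ ∨ τ ∈ neighbors k σ ∧
      0 < hamiltonian (((r : ℝ) + 1) / 2) γ Y τ - hamiltonian (((r : ℝ) + 1) / 2) γ Y σ := by
  unfold greedyStep at hτ
  split_ifs at hτ with h
  · rw [PMF.mem_support_map_iff] at hτ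
    obtain ⟨σ', hσ', rfl⟩ := hτ
    rw [PMF.mem_support_uniformOfFinset_iff] at hσ'
    split_ifs with h1
    · exact Or.inr ⟨hσ', h1⟩
    · exact Or.inl rfl
  · left
    simpa using hτ

/-- If the accepted moves are those which decrease the potential `Φ`, and the moves to some set `E`
of neighbours decrease it in total by a proportion `η`, then a step of the search contracts the
expected potential. -/
theorem expect_greedyStep_le {σ : Cube n} {Φ : Cube n → ℝ} {η : ℝ} {E : Finset (Cube n)}
    (hacc : ∀ τ ∈ neighbors k σ, (0 < hamiltonian (((r : ℝ) + 1) / 2) γ Y τ -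
      hamiltonian (((r : ℝ) + 1) / 2) γ Y σ) ↔ Φ τ < Φ σ)
    (hE : E ⊆ neighbors k σ) (hη : 0 ≤ η) (hσ : 0 ≤ Φ σ)
    (hpos : ∀ τ ∈ neighbors k σ, Φ τ < Φ σ → 0 ≤ Φ τ)
    (hsum : η * Φ σ ≤ ∑ τ ∈ E, (Φ σ - Φ τ)) :
    expect (greedyStep k γ Y σ) (fun τ => ENNReal.ofReal (Φ τ)) ≤
      ENNReal.ofReal (Real.exp (-(η / n))) * ENNReal.ofReal (Φ σ) := by
  rw [← ENNReal.ofReal_mul (Real.exp_pos _).le]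
  have hexp : (1 - η / n) * Φ σ ≤ Real.exp (-(η / n)) * Φ σ := by
    gcongr
    linarith [Real.add_one_le_exp (-(η / n))]
  unfold greedyStep
  split_ifs with h
  · rw [expect_map, expect_uniformOfFinset]
    set N := neighbors k σ
    have hN : 0 < (N.card : ℝ) := by exact_mod_cast h.card_pos
    have hval : ∀ τ ∈ N, (N.card : ℝ≥0∞)⁻¹ * ENNReal.ofReal (Φ (if 0 <
        hamiltonian (((r : ℝ) + 1) / 2) γ Y τ - hamiltonian (((r : ℝ) + 1) / 2) γ Y σ
        then τ else σ)) =
        ENNReal.ofReal ((N.card : ℝ)⁻¹ * (Φ σ - max (Φ σ - Φ τ) 0)) := by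
      intro τ hτ
      rw [ENNReal.ofReal_mul (by positivity), ENNReal.ofReal_inv_of_pos hN,
        ENNReal.ofReal_natCast]
      congr 2
      split_ifs with h1
      · rw [max_eq_left (by linarith [(hacc τ hτ).mp h1])]
        ring
      · rw [hacc τ hτ] at h1
        rw [max_eq_right (by linarith)]
        ring
    rw [Finset.sum_congr rfl hval, ← ENNReal.ofReal_sum_of_nonneg]
    · refine ENNReal.ofReal_le_ofReal (le_trans ?_ hexp)
      rw [← Finset.mul_sum, Finset.sum_sub_distrib, Finset.sum_const, nsmul_eq_mul]
      -- Rejected moves contribute zero, so the improving neighbours outside `E`, and the worsening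
      -- ones inside it, can only help.
      have h1 : η * Φ σ ≤ ∑ τ ∈ N, max (Φ σ - Φ τ) 0 :=
        calc _ ≤ ∑ τ ∈ E, (Φ σ - Φ τ) := hsum
          _ ≤ ∑ τ ∈ E, max (Φ σ - Φ τ) 0 := Finset.sum_le_sum fun τ _ => le_max_left _ _
          _ ≤ _ := Finset.sum_le_sum_of_subset_of_nonneg hE fun τ _ _ => le_max_right _ _
      have hNn : (N.card : ℝ) ≤ n := by exact_mod_cast card_neighbors_le k σ
      have h2 : η / n ≤ η / N.card := by gcongr
      calc _ ≤ (N.card : ℝ)⁻¹ * (N.card * Φ σ - η * Φ σ) := by gcongr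
        _ = (1 - η / N.card) * Φ σ := by field_simp
        _ ≤ _ := by gcongr
    · intro τ hτ
      refine mul_nonneg (by positivity) ?_
      rcases lt_or_ge (Φ τ) (Φ σ) with h1 | h1
      · rw [max_eq_left (by linarith)]
        linarith [hpos τ hτ h1]
      · rw [max_eq_right (by linarith)]
        linarith
  · rw [expect_pure]
    refine ENNReal.ofReal_le_ofReal (le_trans ?_ hexp)
    -- Without neighbours `E` is empty, so `hsum` forces `η * Φ σ ≤ 0` and staying put is harmless.
    rw [Finset.not_nonempty_iff_eq_empty.mp h, Finset.subset_empty] at hE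
    subst hE
    have h1 : η * Φ σ ≤ 0 := by simpa using hsum
    have h2 : η * Φ σ / n ≤ 0 := div_nonpos_of_nonpos_of_nonneg h1 (by positivity)
    have h3 : η / n * Φ σ = η * Φ σ / n := by ring
    linarith

end Chain

/-! ### Gaussian tails and a union bound over the cube -/

section Noise

theorem hasSubgaussianMGF_gaussianReal : HasSubgaussianMGF id 1 (gaussianReal 0 1) where
  integrable_exp_mul t := by simpa using integrable_exp_mul_gaussianReal (μ := 0) (v := 1) t
  mgf_le t := by rw [mgf_id_gaussianReal]; simp

theorem _root_.ProbabilityTheory.HasSubgaussianMGF.of_le {Ω : Type*} {mΩ : MeasurableSpace Ω}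
    {μ : Measure Ω} {X : Ω → ℝ} {c c' : NNReal} (h : HasSubgaussianMGF X c μ) (hc : c ≤ c') :
    HasSubgaussianMGF X c' μ where
  integrable_exp_mul := h.integrable_exp_mul
  mgf_le t := (h.mgf_le t).trans (by gcongr)

instance (n r : ℕ) : IsProbabilityMeasure (noiseLaw n r) := by
  unfold noiseLaw; infer_instance

theorem hasSubgaussianMGF_tensorInner {n r : ℕ} (f : Tensor n r) :
    HasSubgaussianMGF (fun W => tensorInner f W) (∑ h, (f h ^ 2).toNNReal) (noiseLaw n r) := by
  have hind : iIndepFun (fun (h : Fin r → Fin n) (W : Tensor n r) => f h * W h) (noiseLaw n r) :=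
    iIndepFun_pi (X := fun h x => f h * x) (fun h => by fun_prop)
  refine HasSubgaussianMGF.sum_of_iIndepFun hind fun h _ => ?_
  have h1 : HasSubgaussianMGF (fun W : Tensor n r => W h) 1 (noiseLaw n r) := by
    have hm : (noiseLaw n r).map (fun W : Tensor n r => W h) = gaussianReal 0 1 :=
      (measurePreserving_eval (fun _ : Fin r → Fin n => gaussianReal 0 1) h).map_eq
    exact HasSubgaussianMGF.of_map (X := id) (measurable_pi_apply h).aemeasurable
      (by rw [hm]; exact hasSubgaussianMGF_gaussianReal)
  refine (h1.const_mul (f h)).of_le (le_of_eq ?_)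
  exact (mul_one _).trans (Real.toNNReal_of_nonneg (sq_nonneg (f h))).symm

theorem noiseLaw_abs_tensorInner_gt_le {n r : ℕ} (f : Tensor n r) {t V : ℝ} (ht : 0 ≤ t)
    (hV : 0 < V) (hf : ∑ h, f h ^ 2 ≤ V) :
    noiseLaw n r {W | t < |tensorInner f W|} ≤
      ENNReal.ofReal (2 * Real.exp (-t ^ 2 / (2 * V))) := by
  have hs := hasSubgaussianMGF_tensorInner f
  have hexp : ∀ X : Tensor n r → ℝ,
      HasSubgaussianMGF X (∑ h, (f h ^ 2).toNNReal) (noiseLaw n r) →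
      noiseLaw n r {W | t ≤ X W} ≤ ENNReal.ofReal (Real.exp (-t ^ 2 / (2 * V))) := by
    intro X hX
    have h1 := (hX.of_le (c' := V.toNNReal) (by
      rw [← Real.toNNReal_sum_of_nonneg fun _ _ => sq_nonneg _]
      exact Real.toNNReal_le_toNNReal hf)).measure_ge_le ht
    rw [Real.coe_toNNReal _ hV.le] at h1
    rw [← ENNReal.ofReal_toReal (measure_ne_top (noiseLaw n r) _)]
    exact ENNReal.ofReal_le_ofReal h1
  calc _ ≤ noiseLaw n r ({W | t ≤ tensorInner f W} ∪ {W | t ≤ -tensorInner f W}) := by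
        refine measure_mono fun W hW => ?_
        rcases lt_abs.mp (show t < |tensorInner f W| from hW) with h | h
        · exact Or.inl h.le
        · exact Or.inr h.le
    _ ≤ _ := measure_union_le _ _
    _ ≤ ENNReal.ofReal (Real.exp (-t ^ 2 / (2 * V))) +
        ENNReal.ofReal (Real.exp (-t ^ 2 / (2 * V))) := by
      gcongr
      · exact hexp _ hs
      · exact hexp _ hs.neg
    _ = _ := by rw [← ENNReal.ofReal_add (by positivity) (by positivity), ← two_mul (Real.exp _)]

/-- The number of index tuples in `U` which meet `D`. -/
theorem card_tuples_le {n r : ℕ} (D U : Finset (Fin n)) :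
    ((Finset.univ.filter fun h : Fin r → Fin n => (∃ j, h j ∈ D) ∧ ∀ j, h j ∈ U).card) ≤
      r * (D.card * U.card ^ (r - 1)) := by
  calc _ ≤ (Finset.univ.biUnion fun j : Fin r =>
        Fintype.piFinset (Function.update (fun _ => U) j D)).card := by
        refine Finset.card_le_card fun h hh => ?_
        simp only [Finset.mem_filter, Finset.mem_univ, true_and] at hh
        obtain ⟨⟨j, hj⟩, hU⟩ := hh
        simp only [Finset.mem_biUnion, Finset.mem_univ, true_and, Fintype.mem_piFinset]
        refine ⟨j, fun i => ?_⟩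
        by_cases hij : i = j
        · subst hij; simpa using hj
        · simpa [Function.update_of_ne hij] using hU i
    _ ≤ ∑ j : Fin r, (Fintype.piFinset (Function.update (fun _ => U) j D)).card :=
        Finset.card_biUnion_le
    _ = ∑ j : Fin r, D.card * U.card ^ (r - 1) := by
        refine Finset.sum_congr rfl fun j _ => ?_
        rw [Fintype.card_piFinset, ← Finset.mul_prod_erase _ _ (Finset.mem_univ j)]
        rw [Finset.prod_congr rfl (g := fun _ => U.card)]
        · simp
        · intro i hi
          rw [Function.update_of_ne (Finset.ne_of_mem_erase hi)]
    _ = _ := by simp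

/-- This is the variance of the linear form. Having one index in `D` replaces a factor `U.card` by
`D.card`, which makes the noise small near `θ`. -/
theorem sum_sq_le {n r : ℕ} (f : Tensor n r) (D U : Finset (Fin n)) (B : ℝ)
    (hB : ∀ h, |f h| ≤ B) (hD : ∀ h, f h ≠ 0 → ∃ j, h j ∈ D) (hU : ∀ h, f h ≠ 0 → ∀ j, h j ∈ U) :
    ∑ h, f h ^ 2 ≤ B ^ 2 * (r * (D.card * U.card ^ (r - 1))) := by
  classical
  have h1 : ∀ h, f h ^ 2 ≤ if (∃ j, h j ∈ D) ∧ ∀ j, h j ∈ U then B ^ 2 else 0 := by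
    intro h
    split_ifs with hc
    · rw [← sq_abs]
      exact pow_le_pow_left₀ (abs_nonneg _) (hB h) 2
    · have : f h = 0 := by
        by_contra hne
        exact hc ⟨hD h hne, hU h hne⟩
      simp [this]
  calc _ ≤ ∑ h, if (∃ j, h j ∈ D) ∧ ∀ j, h j ∈ U then B ^ 2 else 0 :=
        Finset.sum_le_sum fun h _ => h1 h
    _ = B ^ 2 * ((Finset.univ.filter fun h : Fin r → Fin n =>
          (∃ j, h j ∈ D) ∧ ∀ j, h j ∈ U).card : ℝ) := by
        rw [← Finset.sum_filter, Finset.sum_const, nsmul_eq_mul, mul_comm]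
    _ ≤ _ := by
        gcongr
        exact_mod_cast card_tuples_le D U

/-- The generating function of the Hamming distance to a fixed point of the cube. -/
theorem sum_pow_hammingDist_le {n : ℕ} (θ : Cube n) {x : ℝ} (hx : 0 ≤ x) :
    ∑ σ : Cube n, x ^ hammingDist σ θ ≤ (x + 1) ^ n := by
  classical
  have h1 := Fintype.sum_pow_mul_eq_add_pow (Fin n) x 1
  simp only [one_pow, mul_one, Fintype.card_fin] at h1
  rw [← h1]
  let e : Cube n → Finset (Fin n) := fun σ => Finset.univ.filter fun i => σ i ≠ θ i
  have he : Function.Injective e := by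
    intro σ τ hστ
    funext i
    have hi : σ i ≠ θ i ↔ τ i ≠ θ i := by
      simpa [e] using congrArg (i ∈ ·) hστ
    revert hi
    generalize σ i = a
    generalize τ i = b
    generalize θ i = c
    revert a b c
    decide
  calc _ = ∑ s ∈ Finset.univ.map ⟨e, he⟩, x ^ s.card := by
        rw [Finset.sum_map]; rfl
    _ ≤ _ := Finset.sum_le_sum_of_subset_of_nonneg (Finset.subset_univ _) fun _ _ _ => by positivity

/-- The weight `n^{-4}` per differing coordinate beats the `n` choices of it: the total is at most
`(1 + n^{-4})^n - 1`, and `n * n^{-4} ≤ 1/100`. -/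
theorem sum_erase_exp_le {n : ℕ} (hn : 5 ≤ n) (θ : Cube n) :
    ∑ σ ∈ Finset.univ.erase θ, Real.exp (-(4 * Real.log n)) ^ hammingDist σ θ ≤ 1 / 99 := by
  have hn0 : (0 : ℝ) < n := by positivity
  have hx : Real.exp (-(4 * Real.log n)) = ((n : ℝ) ^ 4)⁻¹ := by
    rw [Real.exp_neg, mul_comm, Real.exp_mul, Real.exp_log hn0]
    norm_cast
  rw [hx]
  set x : ℝ := ((n : ℝ) ^ 4)⁻¹
  have hx0 : 0 ≤ x := by positivity
  have h1 := sum_pow_hammingDist_le θ hx0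
  rw [← Finset.add_sum_erase _ _ (Finset.mem_univ θ)] at h1
  simp only [hammingDist_self, pow_zero] at h1
  have h2 : (x + 1) ^ n ≤ Real.exp (n * x) := by
    rw [Real.exp_nat_mul]
    gcongr
    exact Real.add_one_le_exp x
  have h3 : n * x ≤ 1 / 100 := by
    have h5 : (5 : ℝ) ≤ n := by exact_mod_cast hn
    have h6 : n * x = ((n : ℝ) ^ 3)⁻¹ := by
      simp only [x]; field_simp
    rw [h6, one_div]
    refine inv_anti₀ (by norm_num) ?_
    calc (100 : ℝ) ≤ 5 ^ 3 := by norm_num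
      _ ≤ _ := by gcongr
  have h4 : Real.exp (n * x) ≤ 1 / (1 - 1 / 100) :=
    calc _ ≤ Real.exp (1 / 100) := Real.exp_le_exp.mpr h3
      _ ≤ _ := Real.exp_bound_div_one_sub_of_interval (by norm_num) (by norm_num)
  norm_num at h4
  linarith

/-- A uniform bound on Gaussian linear forms indexed by the cube, each of which is supported on the
tuples meeting the set where the index differs from `θ`. -/
theorem noiseLaw_exists_gt_le {n r : ℕ} (hr : 1 ≤ r) (hn : 5 ≤ n) {k : ℕ} (hk : 1 ≤ k)
    (θ : Cube n) (P : Cube n → Prop) (F : Cube n → Tensor n r) (U : Cube n → Finset (Fin n))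
    (hB : ∀ σ h, |F σ h| ≤ r)
    (hD : ∀ σ h, F σ h ≠ 0 → ∃ j, σ (h j) ≠ θ (h j))
    (hU : ∀ σ h, F σ h ≠ 0 → ∀ j, h j ∈ U σ)
    (hUc : ∀ σ, P σ → ((U σ).card : ℝ) ≤ 3 * k) :
    noiseLaw n r {W | ∃ σ, P σ ∧ 3 * r ^ 2 * 3 ^ r * hammingDist σ θ *
        ((k : ℝ) ^ (((r : ℝ) - 1) / 2) * Real.sqrt (Real.log n)) < |tensorInner (F σ) W|} ≤
      ENNReal.ofReal (2 / 99) := by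
  classical
  have hk0 : (0 : ℝ) < k := by exact_mod_cast hk
  have hr0 : (0 : ℝ) < r := by exact_mod_cast hr
  have hlog : 0 ≤ Real.log n := Real.log_natCast_nonneg n
  set κ : ℝ := (k : ℝ) ^ (((r : ℝ) - 1) / 2) with hκ
  have hκ2 : κ ^ 2 = (k : ℝ) ^ (r - 1) := by
    rw [hκ, ← Real.rpow_natCast, ← Real.rpow_mul hk0.le, ← Real.rpow_natCast]
    congr 1
    push_cast [hr]
    ring
  have hκ0 : 0 < κ := by positivity
  let t : Cube n → ℝ := fun σ => 3 * r ^ 2 * 3 ^ r * hammingDist σ θ * (κ * Real.sqrt (Real.log n))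
  have hsingle : ∀ σ ∈ Finset.univ.erase θ, noiseLaw n r {W | P σ ∧ t σ < |tensorInner (F σ) W|} ≤
      ENNReal.ofReal (2 * Real.exp (-(4 * Real.log n)) ^ hammingDist σ θ) := by
    intro σ hσ
    by_cases hP : P σ
    swap
    · simp [hP]
    have hd : 0 < (hammingDist σ θ : ℝ) := by
      exact_mod_cast hammingDist_pos.mpr (Finset.ne_of_mem_erase hσ)
    set d : ℝ := (hammingDist σ θ : ℝ)
    have hV : ∑ h, F σ h ^ 2 ≤ (r : ℝ) ^ 2 * (r * (d * (3 * k) ^ (r - 1))) := by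
      refine (sum_sq_le (F σ) (Finset.univ.filter fun i => σ i ≠ θ i) (U σ) r (hB σ)
        (fun h hh => by simpa using hD σ h hh) (hU σ)).trans ?_
      have := hUc σ hP
      gcongr
      exact le_rfl
    simp only [hP, true_and]
    refine (noiseLaw_abs_tensorInner_gt_le (F σ) (t := t σ) (by positivity) (by positivity)
      hV).trans (ENNReal.ofReal_le_ofReal ?_)
    rw [← Real.exp_nat_mul]
    gcongr
    change -t σ ^ 2 / _ ≤ d * _
    rw [div_le_iff₀ (by positivity), mul_pow 3, ← hκ2]
    have h9 : (3 : ℝ) ^ r = 3 * 3 ^ (r - 1) := by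
      rw [← pow_succ']; congr 1; omega
    have ht : t σ ^ 2 = 9 * r ^ 4 * 9 * ((3 : ℝ) ^ (r - 1)) ^ 2 * d ^ 2 * κ ^ 2 * Real.log n := by
      simp only [t, h9]
      rw [mul_pow, mul_pow κ, Real.sq_sqrt hlog]
      ring
    rw [ht]
    set T : ℝ := 3 ^ (r - 1)
    have hT : 1 ≤ T := one_le_pow₀ (by norm_num)
    have hr1 : (1 : ℝ) ≤ r := by exact_mod_cast hr
    have hT2 : T ≤ T ^ 2 := by nlinarith
    have hr34 : (r : ℝ) ^ 3 ≤ r ^ 4 := pow_le_pow_right₀ hr1 (by norm_num)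
    -- With `V` the variance bound, this is `2V · 4 d log n ≤ t²`; the constant `3 r² 3^r` in the
    -- threshold is chosen for it.
    have : 8 * ((r : ℝ) ^ 3 * T) * (d ^ 2 * κ ^ 2 * Real.log n) ≤
        81 * (r ^ 4 * T ^ 2) * (d ^ 2 * κ ^ 2 * Real.log n) := by
      gcongr
      norm_num
    nlinarith
  calc _ ≤ noiseLaw n r (⋃ σ ∈ Finset.univ.erase θ, {W | P σ ∧ t σ < |tensorInner (F σ) W|}) := by
        refine measure_mono fun W hW => ?_
        obtain ⟨σ, hP, hσ⟩ := hW
        simp only [Set.mem_iUnion]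
        refine ⟨σ, Finset.mem_erase.mpr ⟨?_, Finset.mem_univ _⟩, hP, hσ⟩
        -- At `σ = θ` the form vanishes, so the strict inequality fails and no probability is spent.
        rintro rfl
        have h0 : F σ = 0 := by
          funext h
          by_contra hne
          obtain ⟨j, hj⟩ := hD σ h hne
          exact hj rfl
        simp [h0, tensorInner] at hσ
    _ ≤ ∑ σ ∈ Finset.univ.erase θ, noiseLaw n r {W | P σ ∧ t σ < |tensorInner (F σ) W|} :=
        measure_biUnion_finset_le _ _
    _ ≤ ∑ σ ∈ Finset.univ.erase θ,
          ENNReal.ofReal (2 * Real.exp (-(4 * Real.log n)) ^ hammingDist σ θ) :=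
        Finset.sum_le_sum hsingle
    _ = ENNReal.ofReal (∑ σ ∈ Finset.univ.erase θ,
          2 * Real.exp (-(4 * Real.log n)) ^ hammingDist σ θ) :=
        (ENNReal.ofReal_sum_of_nonneg fun _ _ => by positivity).symm
    _ ≤ _ := by
        refine ENNReal.ofReal_le_ofReal ?_
        rw [← Finset.mul_sum]
        linarith [sum_erase_exp_le hn θ]

end Noise

/-! ### Supports, overlaps and single-coordinate flips -/

section Combinatorics

variable {n r : ℕ}

/-- The coordinates in the support of `σ` but not in that of `θ`. -/
def extra (σ θ : Cube n) : Finset (Fin n) := Finset.univ.filter fun i => σ i ≠ 0 ∧ θ i = 0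

theorem hammingNorm_eq_sum (σ : Cube n) : (hammingNorm σ : ℝ) = ∑ i, toVec σ i := by
  unfold hammingNorm
  rw [Finset.card_filter]
  push_cast
  refine Finset.sum_congr rfl fun i _ => ?_
  unfold toVec
  generalize σ i = x
  fin_cases x <;> simp

theorem overlap_eq_card (σ θ : Cube n) :
    overlap σ θ = (Finset.univ.filter fun i => σ i ≠ 0 ∧ θ i ≠ 0).card := by
  unfold overlap
  rw [Finset.card_filter]
  push_cast
  refine Finset.sum_congr rfl fun i _ => ?_
  unfold toVec
  generalize σ i = x
  generalize θ i = y
  fin_cases x <;> fin_cases y <;> simp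

theorem overlap_nonneg (σ θ : Cube n) : 0 ≤ overlap σ θ := by
  rw [overlap_eq_card]; positivity

theorem overlap_comm (σ θ : Cube n) : overlap σ θ = overlap θ σ := by
  unfold overlap
  exact Finset.sum_congr rfl fun i _ => mul_comm _ _

theorem hammingNorm_eq_overlap_add (σ θ : Cube n) :
    (hammingNorm σ : ℝ) = overlap σ θ + (extra σ θ).card := by
  rw [overlap_eq_card, hammingNorm, extra, ← Nat.cast_add, Nat.cast_inj, add_comm]
  rw [← Finset.card_union_of_disjoint]
  · congr 1
    ext i
    simp only [Finset.mem_filter, Finset.mem_univ, true_and, Finset.mem_union]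
    tauto
  · rw [Finset.disjoint_filter]
    tauto

theorem hammingDist_eq_extra_add (σ θ : Cube n) :
    hammingDist σ θ = (extra θ σ).card + (extra σ θ).card := by
  rw [hammingDist, extra, extra, ← Finset.card_union_of_disjoint]
  · congr 1
    ext i
    simp only [Finset.mem_filter, Finset.mem_univ, true_and, Finset.mem_union]
    generalize σ i = x
    generalize θ i = y
    revert x y
    decide
  · rw [Finset.disjoint_filter]
    tauto

theorem hammingDist_le_add (σ θ : Cube n) :
    (hammingDist σ θ : ℝ) ≤ hammingNorm σ + hammingNorm θ := by
  rw [hammingDist_eq_extra_add, hammingNorm_eq_overlap_add σ θ, hammingNorm_eq_overlap_add θ σ]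
  push_cast
  linarith [overlap_nonneg σ θ, overlap_nonneg θ σ]

theorem overlap_self (θ : Cube n) : overlap θ θ = hammingNorm θ := by
  rw [hammingNorm_eq_overlap_add θ θ]
  simp [extra]

theorem toVec_update (σ : Cube n) (i j : Fin n) (v : Fin 2) :
    toVec (Function.update σ i v) j =
      toVec σ j + if j = i then ((v : ℕ) : ℝ) - toVec σ i else 0 := by
  unfold toVec
  by_cases h : j = i
  · subst h; simp
  · simp [h]

theorem hammingNorm_update (σ : Cube n) (i : Fin n) (v : Fin 2) :
    (hammingNorm (Function.update σ i v) : ℝ) = hammingNorm σ + (((v : ℕ) : ℝ) - toVec σ i) := by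
  simp_rw [hammingNorm_eq_sum, toVec_update, Finset.sum_add_distrib]
  simp

theorem overlap_update (σ θ : Cube n) (i : Fin n) (v : Fin 2) :
    overlap (Function.update σ i v) θ =
      overlap σ θ + (((v : ℕ) : ℝ) - toVec σ i) * toVec θ i := by
  unfold overlap
  simp_rw [toVec_update, add_mul, Finset.sum_add_distrib]
  simp

theorem update_mem_neighbors {k : ℕ} {σ θ : Cube n} {i : Fin n} (hi : σ i ≠ θ i)
    (hk : (hammingNorm (Function.update σ i (θ i)) : ℝ) ≤ 3 / 2 * k) :
    Function.update σ i (θ i) ∈ neighbors k σ := by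
  simp only [neighbors, Finset.mem_filter, Finset.mem_univ, true_and]
  refine ⟨?_, hk⟩
  unfold hammingDist
  rw [Finset.card_eq_one]
  refine ⟨i, ?_⟩
  ext j
  simp only [Finset.mem_filter, Finset.mem_univ, true_and, Finset.mem_singleton]
  by_cases h : j = i
  · subst h; simpa using hi
  · simp [h]

theorem ne_of_mem_extra {σ θ : Cube n} {i : Fin n} (hi : i ∈ extra σ θ) : σ i ≠ θ i := by
  simp only [extra, Finset.mem_filter, Finset.mem_univ, true_and] at hi
  rw [hi.2]; exact hi.1

theorem toVec_of_mem_extra {σ θ : Cube n} {i : Fin n} (hi : i ∈ extra σ θ) :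
    toVec σ i = 1 ∧ toVec θ i = 0 := by
  simp only [extra, Finset.mem_filter, Finset.mem_univ, true_and] at hi
  unfold toVec
  revert hi
  generalize σ i = x
  generalize θ i = y
  fin_cases x <;> fin_cases y <;> simp

theorem sum_image_update {M : Type*} [AddCommMonoid M] {σ θ : Cube n} (E : Finset (Fin n))
    (hE : ∀ i ∈ E, σ i ≠ θ i) (f : Cube n → M) :
    ∑ τ ∈ E.image (fun i => Function.update σ i (θ i)), f τ =
      ∑ i ∈ E, f (Function.update σ i (θ i)) := by
  refine Finset.sum_image fun i hi j _ hij => ?_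
  by_contra hne
  have := congrFun hij i
  simp only [Function.update_self, Function.update_of_ne hne] at this
  exact hE i hi this.symm

end Combinatorics

/-! ### Tensor powers and their changes under flips -/

section Tensor

variable {n r : ℕ}

theorem tensorInner_add_right (A B C : Tensor n r) :
    tensorInner A (B + C) = tensorInner A B + tensorInner A C := by
  simp [tensorInner, mul_add, Finset.sum_add_distrib]

theorem tensorInner_smul_right (A B : Tensor n r) (c : ℝ) :
    tensorInner A (c • B) = c * tensorInner A B := by
  simp only [tensorInner, Pi.smul_apply, smul_eq_mul, Finset.mul_sum]
  exact Finset.sum_congr rfl fun _ _ => by ring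

theorem tensorInner_sub_left (A B C : Tensor n r) :
    tensorInner (A - B) C = tensorInner A C - tensorInner B C := by
  simp [tensorInner, sub_mul, Finset.sum_sub_distrib]

theorem tensorInner_sum_left {ι : Type*} (s : Finset ι) (A : ι → Tensor n r) (C : Tensor n r) :
    tensorInner (∑ i ∈ s, A i) C = ∑ i ∈ s, tensorInner (A i) C := by
  simp only [tensorInner, Finset.sum_apply, Finset.sum_mul]
  exact Finset.sum_comm

theorem tensorInner_tensorPow (u v : Fin n → ℝ) :
    tensorInner (tensorPow r u) (tensorPow r v) = (∑ i, u i * v i) ^ r := by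
  unfold tensorInner tensorPow
  simp_rw [← Finset.prod_mul_distrib]
  rw [Fintype.sum_pow]

theorem hamiltonian_observation (k : ℕ) (lam β γ : ℝ) (θ σ : Cube n) (W : Tensor n r) :
    hamiltonian β γ (observation k lam θ W) σ =
      lam / (k : ℝ) ^ ((r : ℝ) / 2) * overlap σ θ ^ r + tensorInner (tensorPow r (toVec σ)) W -
        γ * (hammingNorm σ : ℝ) ^ β := by
  rw [hamiltonian, observation, tensorInner_add_right, tensorInner_smul_right,
    tensorInner_tensorPow, overlap]

theorem toVec_mem_Icc (σ : Cube n) (i : Fin n) : toVec σ i ∈ Set.Icc (0 : ℝ) 1 := by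
  unfold toVec
  generalize σ i = x
  fin_cases x <;> simp

theorem tensorPow_mem_Icc (σ : Cube n) (h : Fin r → Fin n) :
    tensorPow r (toVec σ) h ∈ Set.Icc (0 : ℝ) 1 :=
  ⟨Finset.prod_nonneg fun _ _ => (toVec_mem_Icc σ _).1,
    Finset.prod_le_one (fun _ _ => (toVec_mem_Icc σ _).1) fun _ _ => (toVec_mem_Icc σ _).2⟩

theorem abs_tensorPow_sub_le (σ τ : Cube n) (h : Fin r → Fin n) :
    |(tensorPow r (toVec τ) - tensorPow r (toVec σ)) h| ≤ 1 := by
  have h1 := tensorPow_mem_Icc τ h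
  have h2 := tensorPow_mem_Icc σ h
  rw [Pi.sub_apply, abs_le]
  constructor <;> linarith [h1.1, h1.2, h2.1, h2.2]

theorem exists_ne_of_tensorPow_sub_ne_zero {σ τ : Cube n} {h : Fin r → Fin n}
    (hne : (tensorPow r (toVec τ) - tensorPow r (toVec σ)) h ≠ 0) : ∃ j, σ (h j) ≠ τ (h j) := by
  by_contra! hc
  apply hne
  simp [tensorPow, toVec, hc]

theorem forall_ne_of_tensorPow_sub_ne_zero {σ τ : Cube n} {h : Fin r → Fin n}
    (hne : (tensorPow r (toVec τ) - tensorPow r (toVec σ)) h ≠ 0) (j : Fin r) :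
    σ (h j) ≠ 0 ∨ τ (h j) ≠ 0 := by
  by_contra! hc
  apply hne
  have h1 : tensorPow r (toVec τ) h = 0 :=
    Finset.prod_eq_zero (Finset.mem_univ j) (by simp [toVec, hc.2])
  have h2 : tensorPow r (toVec σ) h = 0 :=
    Finset.prod_eq_zero (Finset.mem_univ j) (by simp [toVec, hc.1])
  simp [h1, h2]

/-- The sum over `i ∈ E` of the changes of `σ^{⊗ r}` when the coordinate `i` of `σ` is set to that
of `θ`. -/
noncomputable def flipSum (r : ℕ) (θ σ : Cube n) (E : Finset (Fin n)) : Tensor n r :=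
  ∑ i ∈ E, (tensorPow r (toVec (Function.update σ i (θ i))) - tensorPow r (toVec σ))

theorem exists_of_flip_ne_zero {θ σ : Cube n} {i : Fin n} {h : Fin r → Fin n}
    (hne : (tensorPow r (toVec (Function.update σ i (θ i))) - tensorPow r (toVec σ)) h ≠ 0) :
    ∃ j, h j = i ∧ σ i ≠ θ i := by
  obtain ⟨j, hj⟩ := exists_ne_of_tensorPow_sub_ne_zero hne
  by_cases hji : h j = i
  · refine ⟨j, hji, ?_⟩
    rw [hji] at hj
    simpa using hj
  · simp [hji] at hj

/-- A flip at `i` affects the entry `h` only if `i` is among the at most `r` coordinates occurring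
in `h`, and then by at most one. -/
theorem abs_flipSum_le (θ σ : Cube n) (E : Finset (Fin n)) (h : Fin r → Fin n) :
    |flipSum r θ σ E h| ≤ r := by
  classical
  unfold flipSum
  rw [Finset.sum_apply]
  calc _ ≤ ∑ i ∈ E, |(tensorPow r (toVec (Function.update σ i (θ i))) -
        tensorPow r (toVec σ)) h| := Finset.abs_sum_le_sum_abs _ _
    _ ≤ ∑ i ∈ E, if i ∈ Finset.univ.image h then 1 else 0 := by
        refine Finset.sum_le_sum fun i _ => ?_
        split_ifs with hi
        · exact abs_tensorPow_sub_le _ _ _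
        · refine le_of_eq (abs_eq_zero.mpr ?_)
          by_contra hne
          obtain ⟨j, hj, _⟩ := exists_of_flip_ne_zero hne
          exact hi (Finset.mem_image.mpr ⟨j, Finset.mem_univ _, hj⟩)
    _ = ((E.filter fun i => i ∈ Finset.univ.image h).card : ℝ) := by
        rw [Finset.sum_boole]
    _ ≤ ((Finset.univ.image h).card : ℝ) := by
        gcongr
        intro i hi
        exact (Finset.mem_filter.mp hi).2
    _ ≤ r := by
        have := Finset.card_image_le (s := Finset.univ) (f := h)
        rw [Finset.card_univ, Fintype.card_fin] at this
        exact_mod_cast this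

theorem exists_of_flipSum_ne_zero {θ σ : Cube n} {E : Finset (Fin n)} {h : Fin r → Fin n}
    (hne : flipSum r θ σ E h ≠ 0) :
    ∃ i, (tensorPow r (toVec (Function.update σ i (θ i))) - tensorPow r (toVec σ)) h ≠ 0 := by
  unfold flipSum at hne
  rw [Finset.sum_apply] at hne
  obtain ⟨i, _, hi⟩ := Finset.exists_ne_zero_of_sum_ne_zero hne
  exact ⟨i, hi⟩

end Tensor

/-! ### The good noise event -/

section GoodNoise

variable {n r : ℕ}

/-- The constant of the uniform noise bound. -/
noncomputable def noiseConst (r : ℕ) : ℝ := 3 * r ^ 2 * 3 ^ r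

/-- The scale `k^{(r-1)/2} √(log n)` of the noise per flipped coordinate. -/
noncomputable def noiseScale (n r k : ℕ) : ℝ :=
  (k : ℝ) ^ (((r : ℝ) - 1) / 2) * Real.sqrt (Real.log n)

/-- The noise is bounded, at every sparse point of the cube, in proportion to the distance to
`θ`. -/
structure GoodNoise (k : ℕ) (θ : Cube n) (W : Tensor n r) : Prop where
  diff : ∀ σ : Cube n, (hammingNorm σ : ℝ) ≤ 3 / 2 * k →
    |tensorInner (tensorPow r (toVec θ) - tensorPow r (toVec σ)) W| ≤
      noiseConst r * hammingDist σ θ * noiseScale n r k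
  add : ∀ σ : Cube n, (hammingNorm σ : ℝ) ≤ 3 / 2 * k →
    |tensorInner (flipSum r θ σ (extra θ σ)) W| ≤
      noiseConst r * hammingDist σ θ * noiseScale n r k
  remove : ∀ σ : Cube n, (hammingNorm σ : ℝ) ≤ 3 / 2 * k →
    |tensorInner (flipSum r θ σ (extra σ θ)) W| ≤
      noiseConst r * hammingDist σ θ * noiseScale n r k

theorem card_support_union_le {k : ℕ} {θ σ : Cube n} (hθ : hammingNorm θ = k)
    (hσ : (hammingNorm σ : ℝ) ≤ 3 / 2 * k) :
    ((Finset.univ.filter fun i => σ i ≠ 0 ∨ θ i ≠ 0).card : ℝ) ≤ 3 * k := by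
  have h1 : (Finset.univ.filter fun i => σ i ≠ 0 ∨ θ i ≠ 0).card ≤
      hammingNorm σ + hammingNorm θ := by
    rw [Finset.filter_or]
    exact Finset.card_union_le _ _
  have h2 : ((Finset.univ.filter fun i => σ i ≠ 0 ∨ θ i ≠ 0).card : ℝ) ≤
      hammingNorm σ + hammingNorm θ := by exact_mod_cast h1
  rw [hθ] at h2
  have hk : (0 : ℝ) ≤ k := by positivity
  linarith

/-- Three union bounds, each costing `2/99`. Flips are controlled in sum because bounding each one
uniformly in `σ` this way would give only order `√d · u` per flip, too much to be beaten by a drift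
of order `u` per flip. -/
theorem noiseLaw_not_goodNoise_le (hr : 1 ≤ r) (hn : 5 ≤ n) {k : ℕ} (hk : 1 ≤ k) {θ : Cube n}
    (hθ : hammingNorm θ = k) :
    noiseLaw n r {W | ¬ GoodNoise k θ W} ≤ ENNReal.ofReal (2 / 33) := by
  classical
  let U : Cube n → Finset (Fin n) := fun σ => Finset.univ.filter fun i => σ i ≠ 0 ∨ θ i ≠ 0
  have hflip : ∀ E : Cube n → Finset (Fin n), _ := fun E =>
    noiseLaw_exists_gt_le (r := r) hr hn hk θ (fun σ => (hammingNorm σ : ℝ) ≤ 3 / 2 * k)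
      (fun σ => flipSum r θ σ (E σ)) U (fun σ h => abs_flipSum_le _ _ _ _)
      (fun σ h hne => by
        obtain ⟨i, hi⟩ := exists_of_flipSum_ne_zero hne
        obtain ⟨j, rfl, hj⟩ := exists_of_flip_ne_zero hi
        exact ⟨j, hj⟩)
      (fun σ h hne j => by
        obtain ⟨i, hi⟩ := exists_of_flipSum_ne_zero hne
        simp only [U, Finset.mem_filter, Finset.mem_univ, true_and]
        rcases forall_ne_of_tensorPow_sub_ne_zero hi j with h1 | h1
        · exact Or.inl h1
        · by_cases hij : h j = i
          · right; simpa [hij] using h1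
          · left; simpa [hij] using h1)
      (fun σ hσ => card_support_union_le hθ hσ)
  have hdiff := noiseLaw_exists_gt_le (r := r) hr hn hk θ
      (fun σ => (hammingNorm σ : ℝ) ≤ 3 / 2 * k)
      (fun σ => tensorPow r (toVec θ) - tensorPow r (toVec σ)) U
      (fun σ h => (abs_tensorPow_sub_le _ _ _).trans (by exact_mod_cast hr))
      (fun σ h hne => exists_ne_of_tensorPow_sub_ne_zero hne)
      (fun σ h hne j => by
        simpa only [U, Finset.mem_filter, Finset.mem_univ, true_and] using
          forall_ne_of_tensorPow_sub_ne_zero hne j)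
      (fun σ hσ => card_support_union_le hθ hσ)
  have hadd := hflip fun σ => extra θ σ
  have hrem := hflip fun σ => extra σ θ
  have hsum : ENNReal.ofReal (2 / 33) =
      ENNReal.ofReal (2 / 99) + ENNReal.ofReal (2 / 99) + ENNReal.ofReal (2 / 99) := by
    rw [← ENNReal.ofReal_add (by norm_num) (by norm_num),
      ← ENNReal.ofReal_add (by norm_num) (by norm_num)]
    norm_num
  rw [hsum]
  refine le_trans ?_ (add_le_add (add_le_add hdiff hadd) hrem)
  refine le_trans (measure_mono fun W hW => ?_)
    ((measure_union_le _ _).trans (add_le_add_left (measure_union_le _ _) _))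
  by_contra hc
  simp only [Set.mem_union, Set.mem_ofPred_eq, not_or, not_exists, not_and, not_lt] at hc
  exact hW ⟨hc.1.1, hc.1.2, hc.2⟩

end GoodNoise

/-! ### Secant slopes of powers -/

section RealPowers

theorem rpow_sub_rpow_le {p x y : ℝ} (hp : 1 ≤ p) (hx : 0 ≤ x) (hxy : x ≤ y) :
    y ^ p - x ^ p ≤ p * y ^ (p - 1) * (y - x) := by
  rcases (hx.trans hxy).eq_or_lt with hy | hy
  · obtain rfl : x = y := le_antisymm hxy (hy ▸ hx)
    simp
  have h1 := one_add_mul_self_le_rpow_one_add (s := x / y - 1)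
    (by linarith [div_nonneg hx hy.le]) hp
  rw [add_sub_cancel, Real.div_rpow hx hy.le, le_div_iff₀ (by positivity)] at h1
  have h2 : y ^ p = y ^ (p - 1) * y := by
    rw [← Real.rpow_add_one hy.ne']; congr 1; ring
  have h3 : (1 + p * (x / y - 1)) * y ^ p = y ^ p + p * y ^ (p - 1) * (x - y) := by
    rw [h2]; field_simp
  linarith

/-- Giving up the factor `p` of the tangent bound allows the slope to be taken at the larger
endpoint. -/
theorem le_rpow_sub_rpow {p x y : ℝ} (hp : 1 ≤ p) (hx : 0 ≤ x) (hxy : x ≤ y) :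
    y ^ (p - 1) * (y - x) ≤ y ^ p - x ^ p := by
  have h1 : ∀ z : ℝ, 0 ≤ z → z ^ p = z ^ (p - 1) * z := by
    intro z hz
    rw [← Real.rpow_add_one' hz (by linarith)]
    congr 1; ring
  rw [h1 y (hx.trans hxy), h1 x hx]
  have h2 : x ^ (p - 1) ≤ y ^ (p - 1) := Real.rpow_le_rpow hx hxy (by linarith)
  nlinarith

theorem pow_sub_pow_le {r : ℕ} (hr : 1 ≤ r) {x y : ℝ} (hx : 0 ≤ x) (hxy : x ≤ y) :
    y ^ r - x ^ r ≤ r * y ^ (r - 1) * (y - x) := by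
  have h := rpow_sub_rpow_le (p := r) (by exact_mod_cast hr) hx hxy
  have h1 : ((r : ℝ) - 1) = ((r - 1 : ℕ) : ℝ) := by push_cast [hr]; ring
  rw [h1] at h
  simpa only [Real.rpow_natCast] using h

theorem le_pow_sub_pow {r : ℕ} (hr : 1 ≤ r) {x y : ℝ} (hx : 0 ≤ x) (hxy : x ≤ y) :
    y ^ (r - 1) * (y - x) ≤ y ^ r - x ^ r := by
  have h := le_rpow_sub_rpow (p := r) (by exact_mod_cast hr) hx hxy
  have h1 : ((r : ℝ) - 1) = ((r - 1 : ℕ) : ℝ) := by push_cast [hr]; ring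
  rw [h1] at h
  simpa only [Real.rpow_natCast] using h

end RealPowers

/-! ### Energy landscape on the good event -/

section Energy

variable {n r k : ℕ} {θ : Cube n} {W : Tensor n r}

/-- The constant `C_γ` of the sparsity penalty. -/
noncomputable def gamConst (r : ℕ) : ℝ := 2 * 16 ^ r * (noiseConst r + 1)

/-- The constant `C_λ` of the signal strength. -/
noncomputable def lamConst (r : ℕ) : ℝ :=
  16 ^ r * (6 * noiseConst r + 3 + r * 2 ^ r * gamConst r)

theorem noiseConst_nonneg (r : ℕ) : 0 ≤ noiseConst r := by unfold noiseConst; positivity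

theorem gamConst_pos (r : ℕ) : 0 < gamConst r := by
  have := noiseConst_nonneg r
  unfold gamConst; positivity

theorem lamConst_pos (r : ℕ) : 0 < lamConst r := by
  have := noiseConst_nonneg r
  have := gamConst_pos r
  unfold lamConst; positivity

/-- The objective of the search, with signal strength `s` per tensor entry. -/
noncomputable def energy (s : ℝ) (θ : Cube n) (W : Tensor n r) (σ : Cube n) : ℝ :=
  s * overlap σ θ ^ r + tensorInner (tensorPow r (toVec σ)) W -
    gamConst r * Real.sqrt (Real.log n) * (hammingNorm σ : ℝ) ^ (((r : ℝ) + 1) / 2)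

theorem noiseScale_nonneg (n r k : ℕ) : 0 ≤ noiseScale n r k := by
  unfold noiseScale; positivity

theorem noiseScale_pos (hn : 5 ≤ n) (hk : 1 ≤ k) : 0 < noiseScale n r k := by
  have hk0 : (0 : ℝ) < k := by exact_mod_cast hk
  have hn0 : (1 : ℝ) < n := by exact_mod_cast (by omega : 1 < n)
  have := Real.log_pos hn0
  unfold noiseScale; positivity

theorem exponent_sub_one (r : ℕ) : ((r : ℝ) + 1) / 2 - 1 = ((r : ℝ) - 1) / 2 := by ring

/-- With `le_penalty_slope`, this explains the exponent `(r+1)/2`: the penalty then changes per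
coordinate at the noise scale. -/
theorem penalty_slope_le (hr : 1 ≤ r) {y : ℝ} (hy0 : 0 ≤ y) (hy : y ≤ 2 * k) :
    Real.sqrt (Real.log n) * y ^ (((r : ℝ) - 1) / 2) ≤ 2 ^ r * noiseScale n r k := by
  have hr1 : (1 : ℝ) ≤ r := by exact_mod_cast hr
  have h1 : y ^ (((r : ℝ) - 1) / 2) ≤ 2 ^ r * (k : ℝ) ^ (((r : ℝ) - 1) / 2) :=
    calc _ ≤ (2 * (k : ℝ)) ^ (((r : ℝ) - 1) / 2) := Real.rpow_le_rpow hy0 hy (by linarith)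
      _ = 2 ^ (((r : ℝ) - 1) / 2) * (k : ℝ) ^ (((r : ℝ) - 1) / 2) :=
        Real.mul_rpow (by norm_num) (by positivity)
      _ ≤ 2 ^ (r : ℝ) * (k : ℝ) ^ (((r : ℝ) - 1) / 2) := by
        gcongr
        · norm_num
        · linarith
      _ = _ := by rw [Real.rpow_natCast]
  unfold noiseScale
  calc _ ≤ Real.sqrt (Real.log n) * (2 ^ r * (k : ℝ) ^ (((r : ℝ) - 1) / 2)) := by gcongr
    _ = _ := by ring

theorem le_penalty_slope (hr : 1 ≤ r) {y : ℝ} (hy : (k : ℝ) / 16 ≤ y) :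
    noiseScale n r k ≤ 16 ^ r * (Real.sqrt (Real.log n) * y ^ (((r : ℝ) - 1) / 2)) := by
  have hr1 : (1 : ℝ) ≤ r := by exact_mod_cast hr
  have hy0 : 0 ≤ y := le_trans (by positivity) hy
  have h1 : (k : ℝ) ^ (((r : ℝ) - 1) / 2) ≤ 16 ^ r * y ^ (((r : ℝ) - 1) / 2) :=
    calc _ ≤ (16 * y) ^ (((r : ℝ) - 1) / 2) :=
          Real.rpow_le_rpow (by positivity) (by linarith) (by linarith)
      _ = 16 ^ (((r : ℝ) - 1) / 2) * y ^ (((r : ℝ) - 1) / 2) :=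
        Real.mul_rpow (by norm_num) hy0
      _ ≤ 16 ^ (r : ℝ) * y ^ (((r : ℝ) - 1) / 2) := by
        gcongr
        · norm_num
        · linarith
      _ = _ := by rw [Real.rpow_natCast]
  unfold noiseScale
  calc _ ≤ 16 ^ r * y ^ (((r : ℝ) - 1) / 2) * Real.sqrt (Real.log n) := by gcongr
    _ = _ := by ring

theorem penalty_le (hr : 1 ≤ r) {y : ℝ} (hy0 : 0 ≤ y) (hy : y ≤ 2 * k) :
    Real.sqrt (Real.log n) * y ^ (((r : ℝ) + 1) / 2) ≤ 2 * 2 ^ r * k * noiseScale n r k := by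
  have hr1 : (1 : ℝ) ≤ r := by exact_mod_cast hr
  have h1 : y ^ (((r : ℝ) + 1) / 2) = y ^ (((r : ℝ) - 1) / 2) * y := by
    rw [← Real.rpow_add_one' hy0 (by linarith)]; congr 1; ring
  rw [h1, ← mul_assoc]
  have := noiseScale_nonneg n r k
  calc _ ≤ 2 ^ r * noiseScale n r k * (2 * k) :=
        mul_le_mul (penalty_slope_le hr hy0 hy) hy hy0 (by positivity)
    _ = _ := by ring

theorem pow_eq_pow_sub_mul (hr : 1 ≤ r) (x : ℝ) : x ^ r = x ^ (r - 1) * x := by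
  rw [← pow_succ]; congr 1; omega

theorem signal_slope_ge (hr : 1 ≤ r) {s y : ℝ} (hs : 0 ≤ s) (hy : (k : ℝ) / 16 ≤ y) :
    s * (k : ℝ) ^ (r - 1) ≤ 16 ^ r * (s * y ^ (r - 1)) := by
  have hy0 : 0 ≤ y := le_trans (by positivity) hy
  have h1 : (k : ℝ) ^ (r - 1) ≤ 16 ^ r * y ^ (r - 1) :=
    calc _ ≤ (16 * y) ^ (r - 1) := by gcongr; linarith
      _ = 16 ^ (r - 1) * y ^ (r - 1) := mul_pow _ _ _
      _ ≤ _ := by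
        gcongr
        · norm_num
        · omega
  calc _ ≤ s * (16 ^ r * y ^ (r - 1)) := by gcongr
    _ = _ := by ring

/-- The part of the objective which does not depend on the signal oscillates little. -/
theorem abs_energy_sub_signal_le (hr : 1 ≤ r) (hθ : hammingNorm θ = k) (hW : GoodNoise k θ W)
    {σ τ : Cube n} (hσ : (hammingNorm σ : ℝ) ≤ 3 / 2 * k) (hτ : (hammingNorm τ : ℝ) ≤ 3 / 2 * k)
    (s : ℝ) :
    |energy s θ W τ - energy s θ W σ - s * (overlap τ θ ^ r - overlap σ θ ^ r)| ≤
      (5 * noiseConst r + 2 * 2 ^ r * gamConst r) * (k * noiseScale n r k) := by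
  have hk : (0 : ℝ) ≤ k := by positivity
  have hu := noiseScale_nonneg n r k
  have hC := noiseConst_nonneg r
  have hg := gamConst_pos r
  -- The distance to `θ` is at most `3k/2 + k`; comparing both points with `θ` doubles this, whence
  -- `5 * noiseConst r`.
  have hd : ∀ ρ : Cube n, (hammingNorm ρ : ℝ) ≤ 3 / 2 * k → noiseConst r * hammingDist ρ θ *
      noiseScale n r k ≤ noiseConst r * (5 / 2 * k) * noiseScale n r k := by
    intro ρ hρ
    have := hammingDist_le_add ρ θ
    rw [hθ] at this
    gcongr
    linarith
  have h1 := (hW.diff σ hσ).trans (hd σ hσ)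
  have h2 := (hW.diff τ hτ).trans (hd τ hτ)
  rw [tensorInner_sub_left, abs_le] at h1 h2
  have h3 := mul_le_mul_of_nonneg_left (penalty_le (n := n) hr (Nat.cast_nonneg _)
    (by linarith : (hammingNorm σ : ℝ) ≤ 2 * k)) hg.le
  have h4 := mul_le_mul_of_nonneg_left (penalty_le (n := n) hr (Nat.cast_nonneg _)
    (by linarith : (hammingNorm τ : ℝ) ≤ 2 * k)) hg.le
  have h5 : 0 ≤ gamConst r * (Real.sqrt (Real.log n) *
    (hammingNorm σ : ℝ) ^ (((r : ℝ) + 1) / 2)) := by positivity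
  have h6 : 0 ≤ gamConst r * (Real.sqrt (Real.log n) *
    (hammingNorm τ : ℝ) ^ (((r : ℝ) + 1) / 2)) := by positivity
  unfold energy
  rw [abs_le]
  constructor <;> linarith [h1.1, h1.2, h2.1, h2.2]

theorem const_lt_lamConst (hr : 2 ≤ r) :
    16 ^ r * (5 * noiseConst r + 2 * 2 ^ r * gamConst r) < lamConst r := by
  have hC := noiseConst_nonneg r
  have hg := gamConst_pos r
  have hr1 : (2 : ℝ) ≤ r := by exact_mod_cast hr
  unfold lamConst
  have : 2 * 2 ^ r * gamConst r ≤ r * 2 ^ r * gamConst r := by gcongr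
  exact mul_lt_mul_of_pos_left (by linarith) (by positivity)

/-- Points at least as good as a point with overlap `k / 8` have overlap at least `k / 16`. -/
theorem overlap_ge_of_energy_ge (hr : 2 ≤ r) (hn : 5 ≤ n) (hk : 1 ≤ k) (hθ : hammingNorm θ = k)
    (hW : GoodNoise k θ W) {s : ℝ} (hs : lamConst r * noiseScale n r k ≤ s * (k : ℝ) ^ (r - 1))
    {σ₀ σ : Cube n} (h0 : (hammingNorm σ₀ : ℝ) ≤ 3 / 2 * k) (hov : (k : ℝ) / 8 ≤ overlap σ₀ θ)
    (hσ : (hammingNorm σ : ℝ) ≤ 3 / 2 * k) (hle : energy s θ W σ₀ ≤ energy s θ W σ) :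
    (k : ℝ) / 16 ≤ overlap σ θ := by
  by_contra! hc
  have hk0 : (0 : ℝ) < k := by exact_mod_cast hk
  have hu := noiseScale_pos (r := r) hn hk
  have hspos : 0 < s := by
    have h1 : 0 < s * (k : ℝ) ^ (r - 1) :=
      lt_of_lt_of_le (mul_pos (lamConst_pos r) hu) hs
    exact pos_of_mul_pos_left h1 (by positivity)
  have h1 := (abs_le.mp (abs_energy_sub_signal_le (by omega) hθ hW h0 hσ s)).2
  have h2 : overlap σ θ ^ r ≤ ((k : ℝ) / 16) ^ r := pow_le_pow_left₀ (overlap_nonneg _ _) hc.le r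
  have h3 : ((k : ℝ) / 8) ^ r ≤ overlap σ₀ θ ^ r := pow_le_pow_left₀ (by positivity) hov r
  have h4 : 2 * ((k : ℝ) / 16) ^ r ≤ ((k : ℝ) / 8) ^ r := by
    have : (k : ℝ) / 8 = 2 * (k / 16) := by ring
    rw [this, mul_pow]
    gcongr
    exact le_self_pow₀ (by norm_num) (by omega)
  have h5 : s * ((k : ℝ) / 16) ^ r ≤
      (5 * noiseConst r + 2 * 2 ^ r * gamConst r) * (k * noiseScale n r k) := by
    -- Falling from overlap `k/8` below `k/16` loses more signal than noise and penalty can return.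
    have : s * ((k : ℝ) / 16) ^ r ≤ s * (overlap σ₀ θ ^ r - overlap σ θ ^ r) := by
      gcongr; linarith
    linarith
  have h6 : 16 ^ r * (s * ((k : ℝ) / 16) ^ r) = s * (k : ℝ) ^ (r - 1) * k := by
    rw [mul_assoc s, ← pow_eq_pow_sub_mul (by omega), div_pow]
    field_simp
  have h7 := mul_le_mul_of_nonneg_left h5 (by positivity : (0 : ℝ) ≤ 16 ^ r)
  rw [h6] at h7
  have h8 : lamConst r * noiseScale n r k * k ≤ s * (k : ℝ) ^ (r - 1) * k := by gcongr
  have h9 := mul_lt_mul_of_pos_right (const_lt_lamConst hr) (mul_pos hk0 hu)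
  linarith

/-- For a strong signal, changes of the overlap decide whether the objective increases. -/
theorem energy_lt_iff_overlap_lt (hr : 2 ≤ r) (hn : 5 ≤ n) (hk : 1 ≤ k) (hθ : hammingNorm θ = k)
    (hW : GoodNoise k θ W) {s : ℝ}
    (hs : lamConst r * (k * noiseScale n r k) ≤ s * (k : ℝ) ^ (r - 1))
    {σ τ : Cube n} (hσ : (hammingNorm σ : ℝ) ≤ 3 / 2 * k) (hτ : (hammingNorm τ : ℝ) ≤ 3 / 2 * k)
    (hov : (k : ℝ) / 16 ≤ overlap σ θ) (hne : overlap σ θ ≠ overlap τ θ) :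
    energy s θ W σ < energy s θ W τ ↔ overlap σ θ < overlap τ θ := by
  have hk0 : (0 : ℝ) < k := by exact_mod_cast hk
  have hu := noiseScale_pos (r := r) hn hk
  have hspos : 0 < s := by
    have h1 : 0 < s * (k : ℝ) ^ (r - 1) :=
      lt_of_lt_of_le (mul_pos (lamConst_pos r) (mul_pos hk0 hu)) hs
    exact pos_of_mul_pos_left h1 (by positivity)
  have h1 := abs_le.mp (abs_energy_sub_signal_le (by omega) hθ hW hσ hτ s)
  have h9 := mul_lt_mul_of_pos_right (const_lt_lamConst hr) (mul_pos hk0 hu)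
  set Z := (5 * noiseConst r + 2 * 2 ^ r * gamConst r) * (k * noiseScale n r k) with hZ
  have key : ∀ x y : ℝ, 0 ≤ x → x + 1 ≤ y → (k : ℝ) / 16 ≤ y → Z < s * (y ^ r - x ^ r) := by
    intro x y hx hxy hy
    have h2 := le_pow_sub_pow (r := r) (by omega) hx (by linarith : x ≤ y)
    have h3 := signal_slope_ge (r := r) (by omega) hspos.le hy
    have hy0 : 0 ≤ y := by linarith
    have h4 : y ^ (r - 1) * 1 ≤ y ^ (r - 1) * (y - x) := by
      gcongr; linarith
    have h5 : s * y ^ (r - 1) ≤ s * (y ^ r - x ^ r) := by gcongr; linarith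
    have h6 : (16 : ℝ) ^ r * Z < 16 ^ r * (s * y ^ (r - 1)) := by
      rw [hZ]; linarith
    have h7 := lt_of_mul_lt_mul_left h6 (by positivity)
    linarith
  -- Overlaps are integers, so distinct ones differ by at least one.
  have hint : overlap σ θ + 1 ≤ overlap τ θ ∨ overlap τ θ + 1 ≤ overlap σ θ := by
    rw [overlap_eq_card, overlap_eq_card] at hne ⊢
    norm_cast at hne ⊢
    omega
  rcases hint with h | h
  · have h2 := key _ _ (overlap_nonneg _ _) h (by linarith)
    constructor
    · intro _; linarith
    · intro _; linarith [h1.1]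
  · have h2 := key _ _ (overlap_nonneg _ _) h hov
    constructor
    · intro _
      have : s * (overlap τ θ ^ r - overlap σ θ ^ r) =
        -(s * (overlap σ θ ^ r - overlap τ θ ^ r)) := by ring
      linarith [h1.2]
    · intro _; linarith

/-- The accepted moves do not depend on the signal strength once that is large. -/
theorem energy_lt_iff_energy_lt (hr : 2 ≤ r) (hn : 5 ≤ n) (hk : 1 ≤ k) (hθ : hammingNorm θ = k)
    (hW : GoodNoise k θ W) {s s' : ℝ}
    (hs : lamConst r * (k * noiseScale n r k) ≤ s * (k : ℝ) ^ (r - 1))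
    (hs' : lamConst r * (k * noiseScale n r k) ≤ s' * (k : ℝ) ^ (r - 1))
    {σ τ : Cube n} (hσ : (hammingNorm σ : ℝ) ≤ 3 / 2 * k) (hτ : (hammingNorm τ : ℝ) ≤ 3 / 2 * k)
    (hov : (k : ℝ) / 16 ≤ overlap σ θ) :
    energy s θ W σ < energy s θ W τ ↔ energy s' θ W σ < energy s' θ W τ := by
  by_cases hne : overlap σ θ = overlap τ θ
  · unfold energy
    rw [hne]
    constructor <;> intro h <;> linarith
  · rw [energy_lt_iff_overlap_lt hr hn hk hθ hW hs hσ hτ hov hne,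
      energy_lt_iff_overlap_lt hr hn hk hθ hW hs' hσ hτ hov hne]

theorem sum_noise_flip (E : Finset (Fin n)) (σ : Cube n) :
    ∑ i ∈ E, (tensorInner (tensorPow r (toVec (Function.update σ i (θ i)))) W -
      tensorInner (tensorPow r (toVec σ)) W) = tensorInner (flipSum r θ σ E) W := by
  rw [flipSum, tensorInner_sum_left]
  simp_rw [tensorInner_sub_left]

/-- Some admissible moves towards `θ` together increase the objective in proportion to the
distance from `θ`. -/
theorem exists_sum_energy_sub_ge (hr : 2 ≤ r) (hk : 1 ≤ k)
    (hθ : hammingNorm θ = k) (hW : GoodNoise k θ W) {s : ℝ} (hs0 : 0 ≤ s)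
    (hs : lamConst r * noiseScale n r k ≤ s * (k : ℝ) ^ (r - 1)) {σ : Cube n}
    (hσ : (hammingNorm σ : ℝ) ≤ 3 / 2 * k) (hov : (k : ℝ) / 16 ≤ overlap σ θ) :
    ∃ E ⊆ neighbors k σ, E.card ≤ hammingDist σ θ ∧
      hammingDist σ θ * noiseScale n r k ≤ ∑ τ ∈ E, (energy s θ W τ - energy s θ W σ) := by
  have hr1 : 1 ≤ r := by omega
  have hk0 : (1 : ℝ) ≤ k := by exact_mod_cast hk
  have hu := noiseScale_nonneg n r k
  have hC := noiseConst_nonneg r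
  have hg := gamConst_pos r
  have hrr : (1 : ℝ) ≤ r := by exact_mod_cast hr1
  have hp : (1 : ℝ) ≤ ((r : ℝ) + 1) / 2 := by linarith
  have hd := hammingDist_eq_extra_add σ θ
  have hdR : (hammingDist σ θ : ℝ) = (extra θ σ).card + (extra σ θ).card := by exact_mod_cast hd
  have hm := hammingNorm_eq_overlap_add σ θ
  have hkk := hammingNorm_eq_overlap_add θ σ
  rw [hθ, overlap_comm θ σ] at hkk
  set u := noiseScale n r k with hu_def
  set a := ((extra θ σ).card : ℝ)
  set b := ((extra σ θ).card : ℝ)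
  set d := (hammingDist σ θ : ℝ)
  set m := (hammingNorm σ : ℝ)
  have ha0 : 0 ≤ a := by positivity
  have hb0 : 0 ≤ b := by positivity
  have hov0 := overlap_nonneg σ θ
  -- The more numerous kind of error is corrected, so that `d ≤ 2 * max a b`. Additions occur only
  -- when `‖σ‖₀ < k`, so they respect the norm constraint.
  rcases le_or_gt a b with hab | hab
  · refine ⟨(extra σ θ).image fun i => Function.update σ i (θ i), ?_, ?_, ?_⟩
    · intro τ hτ
      obtain ⟨i, hi, rfl⟩ := Finset.mem_image.mp hτ
      refine update_mem_neighbors (ne_of_mem_extra hi) ?_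
      have h1 := toVec_of_mem_extra hi
      have h2 : ((θ i : ℕ) : ℝ) = 0 := h1.2
      rw [hammingNorm_update, h1.1, h2]
      linarith
    · exact Finset.card_image_le.trans (by omega)
    · rw [sum_image_update _ fun i hi => ne_of_mem_extra hi]
      set q := gamConst r * Real.sqrt (Real.log n) * m ^ (((r : ℝ) - 1) / 2)
      have hterm : ∀ i ∈ extra σ θ,
          (tensorInner (tensorPow r (toVec (Function.update σ i (θ i)))) W -
            tensorInner (tensorPow r (toVec σ)) W) + q ≤
          energy s θ W (Function.update σ i (θ i)) - energy s θ W σ := by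
        intro i hi
        have h1 := toVec_of_mem_extra hi
        have h2 : ((θ i : ℕ) : ℝ) = 0 := h1.2
        have hb1 : 1 ≤ b := Nat.one_le_cast.mpr (Finset.card_pos.mpr ⟨i, hi⟩)
        have h3 := le_rpow_sub_rpow hp (by linarith : 0 ≤ m - 1) (by linarith : m - 1 ≤ m)
        rw [exponent_sub_one] at h3
        have h4 := mul_le_mul_of_nonneg_left h3
          (by positivity : 0 ≤ gamConst r * Real.sqrt (Real.log n))
        have h5 : (hammingNorm (Function.update σ i (θ i)) : ℝ) = m - 1 := by
          rw [hammingNorm_update, h1.1, h2]; ring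
        have h6 : overlap (Function.update σ i (θ i)) θ = overlap σ θ := by
          rw [overlap_update, h1.2]; ring
        unfold energy
        rw [h5, h6]
        simp only [q]
        linarith
      refine le_trans ?_ (Finset.sum_le_sum hterm)
      rw [Finset.sum_add_distrib, sum_noise_flip, Finset.sum_const, nsmul_eq_mul]
      have h1 := (abs_le.mp (hW.remove σ hσ)).1
      -- Source of `gamConst`: `16^r` pays for `m ≥ k/16`, the `2` for `d ≤ 2b`, and `noiseConst r +
      -- 1` covers the noise and leaves `u`.
      have h2 : 2 * (noiseConst r + 1) * u ≤ q := by
        have h3 := le_penalty_slope (n := n) hr1 (by linarith : (k : ℝ) / 16 ≤ m)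
        have h4 := mul_le_mul_of_nonneg_left h3
          (by positivity : 0 ≤ 2 * (noiseConst r + 1))
        have h5 : q = 2 * (noiseConst r + 1) *
            (16 ^ r * (Real.sqrt (Real.log n) * m ^ (((r : ℝ) - 1) / 2))) := by
          simp only [q, gamConst]; ring
        rw [h5]; exact h4
      have h3 : b * (2 * (noiseConst r + 1) * u) ≤ b * q := by gcongr
      have h4 : d * ((noiseConst r + 1) * u) ≤ (2 * b) * ((noiseConst r + 1) * u) := by
        gcongr; linarith
      change -(noiseConst r * d * u) ≤ _ at h1
      change _ ≤ _ + b * q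
      linarith
  · have hab1 : b + 1 ≤ a := by
      have h : (((extra σ θ).card + 1 : ℕ) : ℝ) ≤ (extra θ σ).card :=
        Nat.cast_le.mpr (Nat.cast_lt.mp hab)
      rwa [Nat.cast_add_one] at h
    refine ⟨(extra θ σ).image fun i => Function.update σ i (θ i), ?_, ?_, ?_⟩
    · intro τ hτ
      obtain ⟨i, hi, rfl⟩ := Finset.mem_image.mp hτ
      refine update_mem_neighbors (ne_of_mem_extra hi).symm ?_
      have h1 := toVec_of_mem_extra hi
      have h2 : ((θ i : ℕ) : ℝ) = 1 := h1.1
      rw [hammingNorm_update, h1.2, h2]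
      linarith
    · exact Finset.card_image_le.trans (by omega)
    · rw [sum_image_update _ fun i hi => (ne_of_mem_extra hi).symm]
      set q := (6 * noiseConst r + 3) * u
      -- The term with `gamConst` pays for the increase of the penalty; the remaining signal gain
      -- `q` beats the noise.
      have hQ : (6 * noiseConst r + 3 + r * 2 ^ r * gamConst r) * u ≤
          s * (overlap σ θ + 1) ^ (r - 1) := by
        have h1 := signal_slope_ge (k := k) (y := overlap σ θ + 1) hr1 hs0 (by linarith)
        have h2 : (16 : ℝ) ^ r * ((6 * noiseConst r + 3 + r * 2 ^ r * gamConst r) * u) ≤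
            16 ^ r * (s * (overlap σ θ + 1) ^ (r - 1)) := by
          refine le_trans (le_of_eq ?_) (hs.trans h1)
          rw [lamConst]; ring
        exact le_of_mul_le_mul_left h2 (by positivity)
      have hterm : ∀ i ∈ extra θ σ,
          (tensorInner (tensorPow r (toVec (Function.update σ i (θ i)))) W -
            tensorInner (tensorPow r (toVec σ)) W) + q ≤
          energy s θ W (Function.update σ i (θ i)) - energy s θ W σ := by
        intro i hi
        have h1 := toVec_of_mem_extra hi
        have h2 : ((θ i : ℕ) : ℝ) = 1 := h1.1
        have h3 := rpow_sub_rpow_le hp (by positivity : 0 ≤ m) (by linarith : m ≤ m + 1)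
        rw [exponent_sub_one] at h3
        have h4 := mul_le_mul_of_nonneg_left h3
          (by positivity : 0 ≤ gamConst r * Real.sqrt (Real.log n))
        have h5 : (hammingNorm (Function.update σ i (θ i)) : ℝ) = m + 1 := by
          rw [hammingNorm_update, h1.2, h2]; ring
        have h6 : overlap (Function.update σ i (θ i)) θ = overlap σ θ + 1 := by
          rw [overlap_update, h1.1, h1.2, h2]; ring
        have h7 := le_pow_sub_pow hr1 hov0 (by linarith : overlap σ θ ≤ overlap σ θ + 1)
        rw [add_sub_cancel_left, mul_one] at h7
        have h8 := mul_le_mul_of_nonneg_left h7 hs0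
        have h9 := penalty_slope_le (n := n) hr1 (by positivity : 0 ≤ m + 1)
          (by linarith : m + 1 ≤ 2 * k)
        have h10 : gamConst r * (((r : ℝ) + 1) / 2) * (Real.sqrt (Real.log n) *
            (m + 1) ^ (((r : ℝ) - 1) / 2)) ≤ gamConst r * r * (2 ^ r * u) := by
          gcongr
          linarith
        unfold energy
        rw [h5, h6]
        simp only [q]
        linarith
      refine le_trans ?_ (Finset.sum_le_sum hterm)
      rw [Finset.sum_add_distrib, sum_noise_flip, Finset.sum_const, nsmul_eq_mul]
      have h1 := (abs_le.mp (hW.add σ hσ)).1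
      have h4 : d * q ≤ (2 * a) * q := by
        gcongr; linarith
      change -(noiseConst r * d * u) ≤ _ at h1
      change _ ≤ _ + a * q
      have h5 : 0 ≤ d * u := by positivity
      have h6 : 0 ≤ noiseConst r * d * u := by positivity
      simp only [q] at h4 ⊢
      linarith

theorem const_le_lamConst (r : ℕ) :
    noiseConst r + r * 2 ^ r * gamConst r ≤ lamConst r := by
  have hC := noiseConst_nonneg r
  have hg := gamConst_pos r
  unfold lamConst
  have h1 : (1 : ℝ) ≤ 16 ^ r := one_le_pow₀ (by norm_num)
  have h2 : 0 ≤ r * 2 ^ r * gamConst r := by positivity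
  nlinarith

/-- The objective at `θ` exceeds that at `σ` by at most a multiple of their distance. -/
theorem energy_sub_le (hr : 2 ≤ r) (hθ : hammingNorm θ = k) (hW : GoodNoise k θ W) {s : ℝ}
    (hs0 : 0 ≤ s) (hs : lamConst r * noiseScale n r k ≤ s * (k : ℝ) ^ (r - 1)) {σ : Cube n}
    (hσ : (hammingNorm σ : ℝ) ≤ 3 / 2 * k) :
    energy s θ W θ - energy s θ W σ ≤
      hammingDist σ θ * (((r : ℝ) + 1) * (s * (k : ℝ) ^ (r - 1))) := by
  have hr1 : 1 ≤ r := by omega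
  have hk0 : (0 : ℝ) ≤ k := by positivity
  have hu := noiseScale_nonneg n r k
  have hC := noiseConst_nonneg r
  have hg := gamConst_pos r
  have hrr : (1 : ℝ) ≤ r := by exact_mod_cast hr1
  have hp : (1 : ℝ) ≤ ((r : ℝ) + 1) / 2 := by linarith
  have hdR : (hammingDist σ θ : ℝ) = (extra θ σ).card + (extra σ θ).card := by
    exact_mod_cast hammingDist_eq_extra_add σ θ
  have hm := hammingNorm_eq_overlap_add σ θ
  have hkk := hammingNorm_eq_overlap_add θ σ
  rw [hθ, overlap_comm θ σ] at hkk
  have h1 := (abs_le.mp (hW.diff σ hσ)).2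
  rw [tensorInner_sub_left] at h1
  have h2 := mul_le_mul_of_nonneg_left (pow_sub_pow_le hr1 (overlap_nonneg σ θ)
    (by linarith [(Nat.cast_nonneg (extra θ σ).card : (0 : ℝ) ≤ _)] : overlap σ θ ≤ k)) hs0
  unfold energy
  rw [overlap_self, hθ]
  set u := noiseScale n r k with hu_def
  set a := ((extra θ σ).card : ℝ)
  set b := ((extra σ θ).card : ℝ)
  set d := (hammingDist σ θ : ℝ)
  set m := (hammingNorm σ : ℝ)
  have ha0 : 0 ≤ a := by positivity
  have hb0 : 0 ≤ b := by positivity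
  have hpen : gamConst r * Real.sqrt (Real.log n) * (m ^ (((r : ℝ) + 1) / 2) -
      (k : ℝ) ^ (((r : ℝ) + 1) / 2)) ≤ (r * 2 ^ r * gamConst r) * u * d := by
    rcases le_or_gt m k with hmk | hmk
    · have h3 : m ^ (((r : ℝ) + 1) / 2) ≤ (k : ℝ) ^ (((r : ℝ) + 1) / 2) :=
        Real.rpow_le_rpow (by positivity) hmk (by linarith)
      refine (mul_nonpos_of_nonneg_of_nonpos (by positivity) (by linarith)).trans ?_
      positivity
    · have h3 := rpow_sub_rpow_le hp hk0 hmk.le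
      rw [exponent_sub_one] at h3
      have h4 := penalty_slope_le (n := n) hr1 (by positivity : 0 ≤ m) (by linarith : m ≤ 2 * k)
      calc _ ≤ gamConst r * Real.sqrt (Real.log n) *
            (((r : ℝ) + 1) / 2 * m ^ (((r : ℝ) - 1) / 2) * (m - k)) := by gcongr
        _ = gamConst r * (((r : ℝ) + 1) / 2) *
            (Real.sqrt (Real.log n) * m ^ (((r : ℝ) - 1) / 2)) * (m - k) := by ring
        _ ≤ gamConst r * r * (2 ^ r * u) * d := by
          gcongr
          · linarith
          · linarith
        _ = _ := by ring
  -- Noise and penalty together cost at most one more signal slope, turning the factor `r` into `r +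
  -- 1`.
  have h5 : (noiseConst r + r * 2 ^ r * gamConst r) * u * d ≤ s * (k : ℝ) ^ (r - 1) * d := by
    refine mul_le_mul_of_nonneg_right (le_trans ?_ hs) (by positivity)
    exact mul_le_mul_of_nonneg_right (const_le_lamConst r) hu
  have h6 : s * (r * (k : ℝ) ^ (r - 1) * (k - overlap σ θ)) ≤ s * (r * (k : ℝ) ^ (r - 1) * d) := by
    gcongr
    linarith
  linarith

end Energy

/-! ### Recovery of the signal -/

section Recovery

variable {n r k : ℕ} {θ : Cube n} {W : Tensor n r}

/-- The inverse rate of contraction of the optimality gap, per sweep over the coordinates. -/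
noncomputable def sweepConst (r : ℕ) : ℝ := (r + 1) * lamConst r

theorem sweepConst_pos (r : ℕ) : 0 < sweepConst r := by
  have := lamConst_pos r
  unfold sweepConst; positivity

/-- Here `W` is fixed and good, and only the search is random. The gap starts at most `(5/2) *
sweepConst r * k² * u`, contracts by `exp(-1/(sweepConst r * k * n))` per step in expectation, and
is at least `u` off `θ`. -/
theorem five_sixths_le_greedyRun (hr : 2 ≤ r) (hn : 5 ≤ n) (hk : 1 ≤ k) (hθ : hammingNorm θ = k)
    (hW : GoodNoise k θ W) {lam : ℝ}
    (hs : lamConst r * noiseScale n r k ≤ lam / (k : ℝ) ^ ((r : ℝ) / 2) * (k : ℝ) ^ (r - 1))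
    {σ₀ : Cube n} (hov : (k : ℝ) / 8 ≤ overlap σ₀ θ) (h0 : (hammingNorm σ₀ : ℝ) ≤ 3 / 2 * k)
    {t : ℕ} (ht : Real.exp (-(t / (sweepConst r * k * n))) * (5 / 2 * sweepConst r * k ^ 2) ≤
      1 / 6) :
    5 / 6 ≤ greedyRun k (gamConst r * Real.sqrt (Real.log n)) (observation k lam θ W) σ₀ t θ := by
  classical
  have hr1 : 1 ≤ r := by omega
  have hk0 : (0 : ℝ) < k := by exact_mod_cast hk
  have hu := noiseScale_pos (r := r) hn hk
  have hCl := lamConst_pos r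
  have hsw := sweepConst_pos r
  set u := noiseScale n r k with hu_def
  set s := lam / (k : ℝ) ^ ((r : ℝ) / 2) with hs_def
  set Y := observation k lam θ W
  set γ := gamConst r * Real.sqrt (Real.log n)
  have hK : (0 : ℝ) < (k : ℝ) ^ (r - 1) := by positivity
  set s₁ := lamConst r * (k * u) / (k : ℝ) ^ (r - 1)
  have hs₁ : s₁ * (k : ℝ) ^ (r - 1) = lamConst r * (k * u) := div_mul_cancel₀ _ hK.ne'
  have huk : u ≤ k * u := le_mul_of_one_le_left hu.le (by exact_mod_cast hk)
  -- The potential uses the capped strength `s'`, while the search runs with `s`; `hacc` shows that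
  -- both accept the same moves from `R`.
  set s' := min s s₁
  have hs'low : lamConst r * u ≤ s' * (k : ℝ) ^ (r - 1) := by
    rcases min_choice s s₁ with h | h
    · simp only [s', h]; exact hs
    · simp only [s', h]; rw [hs₁]; gcongr
  have hs'up : s' * (k : ℝ) ^ (r - 1) ≤ lamConst r * (k * u) := by
    rw [← hs₁]
    gcongr
    exact min_le_right _ _
  have hs'0 : 0 ≤ s' :=
    (pos_of_mul_pos_left (lt_of_lt_of_le (mul_pos hCl hu) hs'low) hK.le).le
  let R : Set (Cube n) := {σ | (hammingNorm σ : ℝ) ≤ 3 / 2 * k ∧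
    energy s' θ W σ₀ ≤ energy s' θ W σ}
  have hσ₀R : σ₀ ∈ R := ⟨h0, le_rfl⟩
  have hRov : ∀ σ ∈ R, (k : ℝ) / 16 ≤ overlap σ θ := fun σ hσ =>
    overlap_ge_of_energy_ge hr hn hk hθ hW hs'low h0 hov hσ.1 hσ.2
  have hnb : ∀ σ τ : Cube n, τ ∈ neighbors k σ → (hammingNorm τ : ℝ) ≤ 3 / 2 * k := by
    intro σ τ hτ
    simp only [neighbors, Finset.mem_filter] at hτ
    exact hτ.2.2
  have hham : ∀ σ, hamiltonian (((r : ℝ) + 1) / 2) γ Y σ = energy s θ W σ := fun σ =>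
    hamiltonian_observation k lam _ _ θ σ W
  have hacc : ∀ σ ∈ R, ∀ τ ∈ neighbors k σ, (0 < hamiltonian (((r : ℝ) + 1) / 2) γ Y τ -
      hamiltonian (((r : ℝ) + 1) / 2) γ Y σ) ↔ energy s' θ W σ < energy s' θ W τ := by
    intro σ hσ τ hτ
    rw [hham, hham, sub_pos]
    rcases le_total s s₁ with h | h
    · simp only [s', min_eq_left h]
    · simp only [s', min_eq_right h]
      refine energy_lt_iff_energy_lt hr hn hk hθ hW ?_ hs₁.ge hσ.1 (hnb σ τ hτ) (hRov σ hσ)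
      rw [← hu_def, ← hs₁]
      gcongr
  have hRstep : ∀ σ ∈ R, (greedyStep k γ Y σ).support ⊆ R := by
    intro σ hσ τ hτ
    rcases support_greedyStep hτ with rfl | ⟨h1, h2⟩
    · exact hσ
    · rw [hacc σ hσ τ h1] at h2
      exact ⟨hnb σ τ h1, hσ.2.trans h2.le⟩
  have hprog := fun σ (hσ : σ ∈ R) =>
    exists_sum_energy_sub_ge hr hk hθ hW hs'0 hs'low hσ.1 (hRov σ hσ)
  have hmove : ∀ σ ∈ R, σ ≠ θ → ∃ τ ∈ R, u ≤ energy s' θ W τ - energy s' θ W σ := by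
    intro σ hσ hne
    obtain ⟨E, hE, hcard, hsum⟩ := hprog σ hσ
    have hd : (0 : ℝ) < hammingDist σ θ := by exact_mod_cast hammingDist_pos.mpr hne
    have hEne : E.Nonempty := by
      by_contra h
      rw [Finset.not_nonempty_iff_eq_empty] at h
      rw [h, Finset.sum_empty] at hsum
      exact absurd hsum (not_le.mpr (mul_pos hd hu))
    have hsum' : ∑ _τ ∈ E, u ≤ ∑ τ ∈ E, (energy s' θ W τ - energy s' θ W σ) := by
      rw [Finset.sum_const, nsmul_eq_mul]
      refine le_trans ?_ hsum
      gcongr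
    -- At most `d` moves gain `d * u` in total, so one of them gains `u`.
    obtain ⟨τ, hτ, hle⟩ := Finset.exists_le_of_sum_le hEne hsum'
    exact ⟨τ, ⟨hnb σ τ (hE hτ), by linarith [hσ.2]⟩, hle⟩
  have hmax : ∀ σ ∈ R, energy s' θ W σ ≤ energy s' θ W θ := by
    -- A maximiser on the finite set `R` other than `θ` could be improved within `R`.
    obtain ⟨ρ, hρ, hρmax⟩ := Set.exists_max_image R (energy s' θ W) (Set.toFinite R) ⟨σ₀, hσ₀R⟩
    by_cases hρθ : ρ = θ
    · subst hρθ; exact hρmax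
    · obtain ⟨τ, hτ, hle⟩ := hmove ρ hρ hρθ
      linarith [hρmax τ hτ]
  let Φ : Cube n → ℝ := fun σ => energy s' θ W θ - energy s' θ W σ
  have hΦ : ∀ σ ∈ R, Φ σ ≤ hammingDist σ θ * (sweepConst r * (k * u)) := by
    intro σ hσ
    refine (energy_sub_le hr hθ hW hs'0 hs'low hσ.1).trans ?_
    unfold sweepConst
    rw [mul_assoc ((r : ℝ) + 1)]
    gcongr
  have hcontr : ∀ σ ∈ R, expect (greedyStep k γ Y σ) (fun τ => ENNReal.ofReal (Φ τ)) ≤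
      ENNReal.ofReal (Real.exp (-((sweepConst r * k)⁻¹ / n))) * ENNReal.ofReal (Φ σ) := by
    intro σ hσ
    obtain ⟨E, hE, _, hsum⟩ := hprog σ hσ
    refine expect_greedyStep_le (E := E) ?_ hE (by positivity) (sub_nonneg.mpr (hmax σ hσ)) ?_ ?_
    · intro τ hτ
      rw [hacc σ hσ τ hτ]
      simp only [Φ]
      constructor <;> intro h <;> linarith
    · intro τ hτ hlt
      exact sub_nonneg.mpr (hmax τ ⟨hnb σ τ hτ, by simp only [Φ] at hlt; linarith [hσ.2]⟩)
    · calc _ ≤ (sweepConst r * k)⁻¹ * (hammingDist σ θ * (sweepConst r * (k * u))) := by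
            gcongr; exact hΦ σ hσ
        _ = hammingDist σ θ * u := by field_simp
        _ ≤ _ := by
            refine hsum.trans (le_of_eq (Finset.sum_congr rfl fun τ _ => ?_))
            simp only [Φ]; ring
  have hrun := expect_greedyRun_le hσ₀R hRstep _ _ hcontr t
  have hΦ₀ : Φ σ₀ ≤ 5 / 2 * sweepConst r * k ^ 2 * u := by
    refine (hΦ σ₀ hσ₀R).trans ?_
    have h1 := hammingDist_le_add σ₀ θ
    rw [hθ] at h1
    calc _ ≤ (5 / 2 * k) * (sweepConst r * (k * u)) := by gcongr; linarith
      _ = _ := by ring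
  have hfail : expect (greedyRun k γ Y σ₀ t) (fun τ => ENNReal.ofReal (Φ τ)) /
      ENNReal.ofReal u ≤ 1 / 6 := by
    rw [ENNReal.div_le_iff (by simpa using hu) ENNReal.ofReal_ne_top]
    refine hrun.trans ?_
    have h6 : (1 / 6 : ℝ≥0∞) = ENNReal.ofReal (1 / 6) := by
      rw [ENNReal.ofReal_div_of_pos (by norm_num)]; simp
    rw [h6, ← ENNReal.ofReal_pow (Real.exp_pos _).le, ← ENNReal.ofReal_mul (by positivity),
      ← ENNReal.ofReal_mul (by positivity)]
    refine ENNReal.ofReal_le_ofReal ?_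
    rw [← Real.exp_nat_mul]
    have h7 : (t : ℝ) * -((sweepConst r * k)⁻¹ / n) = -(t / (sweepConst r * k * n)) := by
      rw [div_eq_mul_inv, div_eq_mul_inv, mul_inv (sweepConst r * k)]; ring
    rw [h7]
    calc _ ≤ Real.exp (-(t / (sweepConst r * k * n))) * (5 / 2 * sweepConst r * k ^ 2 * u) := by
          gcongr
      _ = Real.exp (-(t / (sweepConst r * k * n))) * (5 / 2 * sweepConst r * k ^ 2) * u := by ring
      _ ≤ _ := by gcongr
  have hmarkov := one_le_add_expect_div (greedyRun k γ Y σ₀ t) (fun τ => ENNReal.ofReal (Φ τ)) θ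
    (ENNReal.ofReal u) (by simpa using hu) ENNReal.ofReal_ne_top (by
      intro σ hσ hne
      have hσR := support_greedyRun_subset hσ₀R hRstep t hσ
      obtain ⟨τ, hτ, hle⟩ := hmove σ hσR hne
      exact ENNReal.ofReal_le_ofReal (by simp only [Φ]; linarith [hmax τ hτ]))
  have h1 : (1 : ℝ≥0∞) = 5 / 6 + 1 / 6 := by
    rw [ENNReal.div_add_div_same]
    norm_num
    exact (ENNReal.div_self (by norm_num) (by norm_num)).symm
  have h2 : (5 / 6 : ℝ≥0∞) + 1 / 6 ≤ greedyRun k γ Y σ₀ t θ + 1 / 6 := by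
    rw [← h1]
    exact hmarkov.trans (by gcongr)
  exact (ENNReal.add_le_add_iff_right (by simp)).mp h2

/-- The drift needs only `λ k^{r/2-1} ≥ lamConst r * u`; as `k ≤ n`, the assumed bound with
`n^{(r-1)/2}` is stronger. -/
theorem signal_strength_ge (hr : 2 ≤ r) (hk : 1 ≤ k) (hkn : k ≤ n) {lam : ℝ}
    (hlam : lamConst r * ((n : ℝ) ^ (((r : ℝ) - 1) / 2) / (k : ℝ) ^ ((r : ℝ) / 2 - 1)) *
      Real.sqrt (Real.log n) ≤ lam) :
    lamConst r * noiseScale n r k ≤ lam / (k : ℝ) ^ ((r : ℝ) / 2) * (k : ℝ) ^ (r - 1) := by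
  have hk0 : (0 : ℝ) < k := by exact_mod_cast hk
  have hCl := lamConst_pos r
  have hr2 : (2 : ℝ) ≤ r := by exact_mod_cast hr
  have h1 : (k : ℝ) ^ (r - 1) = (k : ℝ) ^ ((r : ℝ) / 2) * (k : ℝ) ^ ((r : ℝ) / 2 - 1) := by
    rw [← Real.rpow_add hk0, ← Real.rpow_natCast]
    congr 1
    push_cast [show 1 ≤ r by omega]
    ring
  have h2 : lam / (k : ℝ) ^ ((r : ℝ) / 2) * (k : ℝ) ^ (r - 1) =
      lam * (k : ℝ) ^ ((r : ℝ) / 2 - 1) := by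
    rw [h1]; field_simp
  have h3 : (k : ℝ) ^ (((r : ℝ) - 1) / 2) ≤ (n : ℝ) ^ (((r : ℝ) - 1) / 2) :=
    Real.rpow_le_rpow hk0.le (by exact_mod_cast hkn) (by linarith)
  rw [h2]
  calc lamConst r * noiseScale n r k ≤
        lamConst r * ((n : ℝ) ^ (((r : ℝ) - 1) / 2) * Real.sqrt (Real.log n)) := by
        unfold noiseScale; gcongr
    _ = lamConst r * ((n : ℝ) ^ (((r : ℝ) - 1) / 2) / (k : ℝ) ^ ((r : ℝ) / 2 - 1)) *
          Real.sqrt (Real.log n) * (k : ℝ) ^ ((r : ℝ) / 2 - 1) := by field_simp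
    _ ≤ _ := by gcongr

theorem exists_forall_exp_sqrt_mul_le (c A : ℝ) (hc : 0 < c) :
    ∃ K : ℝ, ∀ k : ℝ, K ≤ k → Real.exp (-(c * Real.sqrt k)) * (A * k ^ 2) ≤ 1 / 6 := by
  have h1 := (Real.tendsto_pow_mul_exp_neg_atTop_nhds_zero 4).comp
    (Real.tendsto_sqrt_atTop.const_mul_atTop hc)
  have h2 := h1.const_mul (A / c ^ 4)
  rw [mul_zero] at h2
  obtain ⟨K, hK⟩ := Filter.eventually_atTop.mp
    (h2.eventually (eventually_le_nhds (by norm_num : (0 : ℝ) < 1 / 6)))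
  refine ⟨max K 0, fun k hk => ?_⟩
  have h3 := hK k (le_of_max_le_left hk)
  refine le_trans (le_of_eq ?_) h3
  simp only [Function.comp_apply]
  have h4 : Real.sqrt k ^ 4 = k ^ 2 := by
    calc _ = (Real.sqrt k ^ 2) ^ 2 := by ring
      _ = _ := by rw [Real.sq_sqrt (le_of_max_le_right hk)]
  rw [mul_pow, h4]
  field_simp

theorem two_thirds_le_successProb (hr : 2 ≤ r) (hn : 5 ≤ n) (hk : 1 ≤ k) (hθ : hammingNorm θ = k)
    {lam : ℝ}
    (hs : lamConst r * noiseScale n r k ≤ lam / (k : ℝ) ^ ((r : ℝ) / 2) * (k : ℝ) ^ (r - 1))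
    {M : ℕ} (ht : Real.exp (-((M - 1 : ℕ) / (sweepConst r * k * n))) *
      (5 / 2 * sweepConst r * k ^ 2) ≤ 1 / 6) {σ₀ : Tensor n r → Cube n}
    (hσ₀ : ∀ᵐ W ∂(noiseLaw n r), (k : ℝ) / 8 ≤ overlap (σ₀ W) θ ∧
      (hammingNorm (σ₀ W) : ℝ) ≤ 3 / 2 * (k : ℝ)) :
    2 / 3 ≤ successProb k lam (gamConst r * Real.sqrt (Real.log n)) M σ₀ θ := by
  -- A measurable hull of the bad event has the same measure and spares a measurability proof.
  set B := toMeasurable (noiseLaw n r) {W | ¬ GoodNoise k θ W}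
  have hB : MeasurableSet B := measurableSet_toMeasurable _ _
  have hBle : noiseLaw n r B ≤ ENNReal.ofReal (2 / 33) := by
    rw [measure_toMeasurable]
    exact noiseLaw_not_goodNoise_le (by omega) hn hk hθ
  have hBc : ENNReal.ofReal (31 / 33) ≤ noiseLaw n r Bᶜ := by
    rw [prob_compl_eq_one_sub hB]
    refine le_trans (le_of_eq ?_) (tsub_le_tsub_left hBle 1)
    rw [← ENNReal.ofReal_one, ← ENNReal.ofReal_sub _ (by norm_num)]
    norm_num
  have h56 : (5 / 6 : ℝ≥0∞) = ENNReal.ofReal (5 / 6) := by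
    rw [ENNReal.ofReal_div_of_pos (by norm_num)]; simp
  have h23 : (2 / 3 : ℝ≥0∞) = ENNReal.ofReal (2 / 3) := by
    rw [ENNReal.ofReal_div_of_pos (by norm_num)]; simp
  -- `5/6 · 31/33 = 155/198 > 2/3`.
  calc (2 / 3 : ℝ≥0∞) ≤ 5 / 6 * noiseLaw n r Bᶜ := by
        refine le_trans ?_ (mul_le_mul_right hBc _)
        rw [h56, h23, ← ENNReal.ofReal_mul (by norm_num)]
        exact ENNReal.ofReal_le_ofReal (by norm_num)
    _ = ∫⁻ W, Bᶜ.indicator (fun _ => 5 / 6) W ∂(noiseLaw n r) :=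
        (lintegral_indicator_const hB.compl _).symm
    _ ≤ _ := by
        refine lintegral_mono_ae ?_
        filter_upwards [hσ₀] with W hW
        refine Set.indicator_apply_le' (fun hWB => ?_) (fun _ => zero_le)
        have hgood : GoodNoise k θ W := by
          by_contra h
          exact hWB (subset_toMeasurable _ _ h)
        exact five_sixths_le_greedyRun hr hn hk hθ hgood hs hW.1 hW.2 ht

theorem le_lintegral_signalLaw (hkn : k ≤ n) {f : Cube n → ℝ≥0∞} {p : ℝ≥0∞}
    (hf : ∀ θ ∈ sparseCube n k, p ≤ f θ) : p ≤ ∫⁻ θ, f θ ∂(signalLaw n k) := by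
  have hne : (sparseCube n k).Nonempty := by
    refine ⟨fun i => if (i : ℕ) < k then 1 else 0, ?_⟩
    change hammingNorm _ = k
    unfold hammingNorm
    have h1 : (Finset.univ.filter fun i : Fin n =>
        (if (i : ℕ) < k then (1 : Fin 2) else 0) ≠ 0) =
        Finset.univ.filter fun i : Fin n => (i : ℕ) < k := by
      ext i; simp
    rw [h1, Fin.card_filter_val_lt]
    exact min_eq_right hkn
  have : IsProbabilityMeasure (signalLaw n k) :=
    isProbabilityMeasure_uniformOn (Set.toFinite _) hne
  have hae : ∀ᵐ θ ∂(signalLaw n k), θ ∈ sparseCube n k :=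
    mem_ae_iff_prob_eq_one (Set.toFinite _).measurableSet |>.mpr
      (uniformOn_eq_one_of (Set.toFinite _) hne subset_rfl)
  calc p = ∫⁻ _, p ∂(signalLaw n k) := by simp
    _ ≤ _ := lintegral_mono_ae (hae.mono hf)

theorem steps_ge (hr : 2 ≤ r) (hk : 1 ≤ k) (hn : 1 ≤ n) {c' : ℝ} (hc' : 0 < c')
    (hk' : 2 / c' ≤ k) {M : ℕ}
    (hM : c' * ((n : ℝ) * (k : ℝ) ^ (((r : ℝ) + 1) / 2)) ≤ M) :
    c' / (2 * sweepConst r) * Real.sqrt k ≤ (M - 1 : ℕ) / (sweepConst r * k * n) := by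
  have hk0 : (1 : ℝ) ≤ k := by exact_mod_cast hk
  have hn0 : (1 : ℝ) ≤ n := by exact_mod_cast hn
  have hr2 : (2 : ℝ) ≤ r := by exact_mod_cast hr
  have hsw := sweepConst_pos r
  have h1 : (k : ℝ) * Real.sqrt k ≤ (k : ℝ) ^ (((r : ℝ) + 1) / 2) :=
    calc (k : ℝ) * Real.sqrt k = (k : ℝ) ^ (1 + 1 / 2 : ℝ) := by
          rw [Real.rpow_add (by linarith), Real.rpow_one, Real.sqrt_eq_rpow]
      _ ≤ _ := Real.rpow_le_rpow_of_exponent_le hk0 (by linarith)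
  have h2 : c' * (n * (k * Real.sqrt k)) ≤ M := le_trans (by gcongr) hM
  have hsqrt : 1 ≤ Real.sqrt k := Real.one_le_sqrt.mpr hk0
  -- Being at least `2`, this lower bound for `M` loses at most half in passing to `M - 1`.
  have h3 : 2 ≤ c' * (n * (k * Real.sqrt k)) := by
    rw [div_le_iff₀ hc'] at hk'
    calc (2 : ℝ) ≤ c' * (1 * (k * 1)) := by linarith
      _ ≤ _ := by gcongr
  have hM1 : 1 ≤ M := by
    have : (1 : ℝ) ≤ M := by linarith
    exact_mod_cast this
  rw [le_div_iff₀ (by positivity)]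
  push_cast [hM1]
  have h4 : c' / (2 * sweepConst r) * Real.sqrt k * (sweepConst r * k * n) =
      c' * (n * (k * Real.sqrt k)) / 2 := by field_simp
  rw [h4]
  linarith

end Recovery

end SparseTensorPCA

theorem theorem2p3 (r : ℕ) (hr : 2 ≤ r) :
    ∃ Clam > (0 : ℝ), ∃ Cgam > (0 : ℝ),
      ∀ c > (0 : ℝ), ∀ c' > (0 : ℝ), ∃ N : ℕ, ∀ n ≥ N,
        ∀ (k M : ℕ) (lam : ℝ)
          (σ₀ : SparseTensorPCA.Cube n → SparseTensorPCA.Tensor n r → SparseTensorPCA.Cube n),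
          c * Real.sqrt n ≤ k → k ≤ n →
          Clam * ((n : ℝ) ^ (((r : ℝ) - 1) / 2) / (k : ℝ) ^ ((r : ℝ) / 2 - 1))
              * Real.sqrt (Real.log n) ≤ lam →
          c' * ((n : ℝ) * (k : ℝ) ^ (((r : ℝ) + 1) / 2)) ≤ M →
          (∀ θ, Measurable (σ₀ θ)) →
          (∀ θ ∈ SparseTensorPCA.sparseCube n k,
            ∀ᵐ W ∂(SparseTensorPCA.noiseLaw n r),
              (k : ℝ) / 8 ≤ SparseTensorPCA.overlap (σ₀ θ W) θ ∧
                (hammingNorm (σ₀ θ W) : ℝ) ≤ 3 / 2 * (k : ℝ)) →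
          (∀ θ ∈ SparseTensorPCA.sparseCube n k,
            2 / 3 ≤ SparseTensorPCA.successProb k lam (Cgam * Real.sqrt (Real.log n)) M
              (σ₀ θ) θ) ∧
          2 / 3 ≤ ∫⁻ θ, SparseTensorPCA.successProb k lam (Cgam * Real.sqrt (Real.log n)) M
              (σ₀ θ) θ ∂(SparseTensorPCA.signalLaw n k) := by
  refine ⟨SparseTensorPCA.lamConst r, SparseTensorPCA.lamConst_pos r,
    SparseTensorPCA.gamConst r, SparseTensorPCA.gamConst_pos r, fun c hc c' hc' => ?_⟩
  have hsw := SparseTensorPCA.sweepConst_pos r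
  obtain ⟨K, hK⟩ := SparseTensorPCA.exists_forall_exp_sqrt_mul_le
    (c' / (2 * SparseTensorPCA.sweepConst r)) (5 / 2 * SparseTensorPCA.sweepConst r)
    (by positivity)
  -- The assumption `c √n ≤ k` serves only to push `k` past a threshold depending on `r` and `c'`.
  have hlarge : ∀ᶠ n : ℕ in Filter.atTop, max K (max (2 / c') 1) ≤ c * Real.sqrt n :=
    ((Real.tendsto_sqrt_atTop.const_mul_atTop hc).comp
      tendsto_natCast_atTop_atTop).eventually_ge_atTop _
  obtain ⟨N, hN⟩ := Filter.eventually_atTop.mp hlarge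
  refine ⟨max N 5, fun n hn k M lam σ₀ hck hkn hlam hM _ hσ₀ => ?_⟩
  have hn5 : 5 ≤ n := le_of_max_le_right hn
  have hbig := (hN n (le_of_max_le_left hn)).trans hck
  have hk1 : 1 ≤ k := by
    have : (1 : ℝ) ≤ k := ((le_max_right _ _).trans (le_max_right _ _)).trans hbig
    exact_mod_cast this
  have hsteps := SparseTensorPCA.steps_ge hr hk1 (by omega : 1 ≤ n) hc'
    (((le_max_left _ _).trans (le_max_right _ _)).trans hbig) hM
  have ht : Real.exp (-((M - 1 : ℕ) / (SparseTensorPCA.sweepConst r * k * n))) *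
      (5 / 2 * SparseTensorPCA.sweepConst r * k ^ 2) ≤ 1 / 6 := by
    refine le_trans ?_ (hK k ((le_max_left _ _).trans hbig))
    gcongr
  have hmain : ∀ θ ∈ SparseTensorPCA.sparseCube n k,
      2 / 3 ≤ SparseTensorPCA.successProb k lam
        (SparseTensorPCA.gamConst r * Real.sqrt (Real.log n)) M (σ₀ θ) θ := fun θ hθ =>
    SparseTensorPCA.two_thirds_le_successProb hr hn5 hk1 hθ
      (SparseTensorPCA.signal_strength_ge hr hk1 hkn hlam) ht (hσ₀ θ hθ)
  exact ⟨hmain, SparseTensorPCA.le_lintegral_signalLaw hkn hmain⟩
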